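/- Let $S^1=\mathbb{R}/\mathbb{Z}$. A \emph{multicritical circle map} is an orientation-preserving homeomorphism $f:S^1\to S^1$ of class $C^3$ having a finite number $N\ge 1$ of critical points (points where the derivative vanishes), each of which is \emph{non-flat}: for every critical point $c$ there are a real number $d>1$, a neighbourhood $W$ of $c$ and a $C^3$ diffeomorphism $\phi:W\to\phi(W)\subset\mathbb{R}$ with $\phi(c)=0$ such that $f(x)=f(c)+\phi(x)\,|\phi(x)|^{d-1}$ for all $x\in W$. The \emph{rotation number} $\rho(f)\in[0,1)$ is $\lim_{n\to\infty}(F^n(x)-x)/n$ modulo $1$, for any lift $F:\mathbb{R}\to\mathbb{R}$ of $f$ and any $x\in\mathbb{R}$. An irrational number is of \emph{bounded type} if the partial quotients of its continued fraction expansion are bounded. A homeomorphism $h:S^1\to S^1$ is \emph{quasisymmetric} if it preserves orientation and there is $K\ge 1$ such that, computing differences with a lift of $h$, $$\frac1K\;\le\;\frac{h(x+t)-h(x)}{h(x)-h(x-t)}\;\le\;K\qquad\text{for all } x \text{ and all } t>0 .$$ Let $f$ and $g$ be two multicritical circle maps (whose numbers of critical points, and whose criticalities $d$, may be different) with the same irrational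 rotation number, and suppose that this number is of bounded type. Then there is a quasisymmetric homeomorphism $h:S^1\to S^1$ with $h\circ f=g\circ h$. Moreover, every homeomorphism $h:S^1\to S^1$ with $h\circ f=g\circ h$ is quasisymmetric. -/

import Mathlib

/-! Orientation preserving homeomorphisms of the circle `ℝ / ℤ`, their lifts and rotation numbers,
multicritical circle maps, numbers of bounded type, and quasisymmetric homeomorphisms. -/

namespace CircleMap

/-- `F` is a lift to the real line of the circle homeomorphism `f`: a strictly increasing
continuous map with `F (x + 1) = F x + 1` that projects to `f`. -/
structure IsLift (F : CircleDeg1Lift) (f : UnitAddCircle ≃ₜ UnitAddCircle) : Prop where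
  continuous : Continuous F
  strictMono : StrictMono F
  coe_eq : ∀ x : ℝ, ((F x : ℝ) : UnitAddCircle) = f (x : UnitAddCircle)

/-- A circle homeomorphism is orientation preserving if it has an increasing lift of degree one. -/
def IsOrientationPreserving (f : UnitAddCircle ≃ₜ UnitAddCircle) : Prop :=
  ∃ F : CircleDeg1Lift, IsLift F f

open Classical in
/-- The rotation number in `[0, 1)` of an orientation preserving circle homeomorphism: the
translation number `lim (F^n x - x) / n` of any lift `F`, reduced modulo one. (The value on
orientation reversing homeomorphisms is irrelevant.) -/
noncomputable def rotationNumber (f : UnitAddCircle ≃ₜ UnitAddCircle) : ℝ :=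
  if hf : IsOrientationPreserving f then Int.fract hf.choose.translationNumber else 0

/-- Two lifts of the same homeomorphism differ by an integer translation. -/
theorem IsLift.exists_int_eq {F G : CircleDeg1Lift} {f : UnitAddCircle ≃ₜ UnitAddCircle}
    (hF : IsLift F f) (hG : IsLift G f) : ∃ m : ℤ, ∀ x : ℝ, F x = m + G x := by
  have hmem : ∀ x : ℝ, F x - G x ∈ Set.range ((↑) : ℤ → ℝ) := by
    intro x
    have h : (((F x - G x : ℝ)) : UnitAddCircle) = 0 := by
      rw [AddCircle.coe_sub, hF.coe_eq, hG.coe_eq, sub_self]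
    obtain ⟨n, hn⟩ := (AddCircle.coe_eq_zero_iff (1 : ℝ)).1 h
    exact ⟨n, by simpa using hn⟩
  obtain ⟨m, hm⟩ := hmem 0
  have hcont : Continuous fun x : ℝ => F x - G x := hF.continuous.sub hG.continuous
  have hdisc : IsDiscrete (Set.range ((↑) : ℤ → ℝ)) :=
    ⟨Int.isClosedEmbedding_coe_real.isEmbedding.toHomeomorph.symm.isEmbedding.discreteTopology⟩
  refine ⟨m, fun x => ?_⟩
  have h := isPreconnected_univ.constant_of_mapsTo hdisc hcont.continuousOn
    (fun x _ => hmem x) (Set.mem_univ x) (Set.mem_univ 0)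
  linarith

/-- The rotation number does not depend on the lift. -/
theorem rotationNumber_eq {F : CircleDeg1Lift} {f : UnitAddCircle ≃ₜ UnitAddCircle}
    (hF : IsLift F f) : rotationNumber f = Int.fract F.translationNumber := by
  have hf : IsOrientationPreserving f := ⟨F, hF⟩
  rw [rotationNumber, dif_pos hf]
  obtain ⟨m, hm⟩ := hf.choose_spec.exists_int_eq hF
  have h1 : hf.choose = (CircleDeg1Lift.translate (Multiplicative.ofAdd (m : ℝ)) : CircleDeg1Lift)
      * F := by
    ext x
    simp [hm x]
  have h2 : Commute (CircleDeg1Lift.translate (Multiplicative.ofAdd (m : ℝ)) : CircleDeg1Lift)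
      F := by
    rw [CircleDeg1Lift.commute_iff_commute]
    intro x
    simp
  rw [h1, CircleDeg1Lift.translationNumber_mul_of_commute h2,
    CircleDeg1Lift.translationNumber_translate, Int.fract_intCast_add]

/-- `c` is a non-flat critical point of degree `d > 1` of the `C^3` map `F`: on a neighbourhood
`W` of `c` one has `F x = F c + φ x * |φ x| ^ (d - 1)`, where `φ` is a `C^3` diffeomorphism of `W`
onto `φ W` with `φ c = 0`. -/
def IsNonFlatCriticalPoint (F : ℝ → ℝ) (c d : ℝ) : Prop :=
  deriv F c = 0 ∧ 1 < d ∧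
    ∃ φ : OpenPartialHomeomorph ℝ ℝ,
      c ∈ φ.source ∧ φ c = 0 ∧
      ContDiffOn ℝ 3 φ φ.source ∧ ContDiffOn ℝ 3 φ.symm φ.target ∧
      ∀ x ∈ φ.source, F x = F c + φ x * |φ x| ^ (d - 1)

/-- The critical points on the circle of the map with lift `F`. -/
def criticalSet (F : CircleDeg1Lift) : Set UnitAddCircle :=
  {c | ∃ x : ℝ, (x : UnitAddCircle) = c ∧ deriv F x = 0}

/-- A multicritical circle map: an orientation preserving `C^3` circle homeomorphism with a finite
nonzero number of critical points, all of them non-flat. (Smoothness and criticality are read off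
a lift; they do not depend on it, as two lifts differ by an integer constant.) -/
def IsMulticritical (f : UnitAddCircle ≃ₜ UnitAddCircle) : Prop :=
  ∃ F : CircleDeg1Lift, IsLift F f ∧ ContDiff ℝ 3 F ∧
    (criticalSet F).Finite ∧ (criticalSet F).Nonempty ∧
    ∀ c : ℝ, deriv F c = 0 → ∃ d : ℝ, IsNonFlatCriticalPoint F c d

/-- A number is of bounded type if the partial quotients of its continued fraction expansion
are bounded. -/
def IsBoundedType (ρ : ℝ) : Prop :=
  ∃ A : ℝ, ∀ (n : ℕ) (a : ℝ), (GenContFract.of ρ).partDens.get? n = some a → a ≤ A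

/-- A quasisymmetric homeomorphism of the circle: it preserves orientation and, for some `K ≥ 1`,
the ratio `(h (x + t) - h x) / (h x - h (x - t))`, computed with a lift of `h`, lies in
`[1 / K, K]` for all `x` and all `t > 0`. -/
def IsQuasisymmetric (h : UnitAddCircle ≃ₜ UnitAddCircle) : Prop :=
  ∃ H : CircleDeg1Lift, IsLift H h ∧ ∃ K : ℝ, 1 ≤ K ∧ ∀ x t : ℝ, 0 < t →
    1 / K ≤ (H (x + t) - H x) / (H x - H (x - t)) ∧
      (H (x + t) - H x) / (H x - H (x - t)) ≤ K

/-- `h` is a topological conjugacy from `f` to `g`, that is, `h ∘ f = g ∘ h`. The homeomorphism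
`h` is not assumed to preserve orientation. -/
def IsConjugacy (h f g : UnitAddCircle ≃ₜ UnitAddCircle) : Prop :=
  ∀ x : UnitAddCircle, h (f x) = g (h x)

end CircleMap

/-! Both maps are linearized. A lift `F` with translation number `α` has a monotone degree-one
semiconjugacy `h` to the translation by `α`; it turns out to be a homeomorphism whose inverse `H` is
quasisymmetric. In linearizing coordinates a conjugacy from `f` to `g` becomes a continuous circle
map commuting with an irrational rotation, hence a rotation (`eq_add_of_commute_rotation`). So every
conjugacy has a lift `x ↦ Hg (hf x + a)`, and such maps are quasisymmetric because inverses and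
compositions of quasisymmetric maps are.

The dynamical input is a cross-ratio inequality for iterates, `exists_crossRatio_iterate_le`. On
intervals of length at most one, `F` multiplies cross-ratios by at most a constant, and on short
intervals without critical points by at most `exp (K * length)`: power maps contract cross-ratios
off the origin, and diffeomorphisms distort slopes by such a factor. If `h` maps an interval to
length `O(1 / N)`, bad approximability of `α` makes its first `N` iterates cover each point
boundedly often. So their lengths have bounded sum, boundedly many of them are long or meet a
critical point, and the total distortion is bounded.

This is applied to `x, G x, G (G x), G (G (G x))`, where `G = F^q - p` with `q ≤ N` and `q * α - p`
of order `1 / N`. As `F` and `G` commute, the cross-ratio at `x` controls those at its first `N`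
iterates. It is bounded below near the minimum of the displacement of `G`, which one of these
iterates reaches; hence it is bounded below everywhere, and the displacements of `G` at `x` and `G
x` are comparable (`exists_comparableDisplacement`). This excludes intervals on which `h` is
constant, and, since `H` carries translation by `s` to `G`, it is the quasisymmetry of `H` at the
scale `s`. These scales are dense enough to give all others. -/

namespace CircleMap

/-! ### Numbers of bounded type are badly approximable -/

/-- All partial quotients of `ξ`, except possibly the integer part, are at most `A`. -/
def PartialQuotientsLE (A ξ : ℝ) : Prop :=
  ∀ (n : ℕ) (a : ℝ), (GenContFract.of ξ).partDens.get? n = some a → a ≤ A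

theorem PartialQuotientsLE.inv_fract {A ξ : ℝ} (h : PartialQuotientsLE A ξ) :
    PartialQuotientsLE A (Int.fract ξ)⁻¹ := by
  intro n a ha
  refine h (n + 1) a ?_
  rw [GenContFract.partDens, Stream'.Seq.map_get?] at ha ⊢
  rwa [GenContFract.of_s_succ]

theorem PartialQuotientsLE.floor_inv_fract_le {A ξ : ℝ} (h : PartialQuotientsLE A ξ)
    (hξ : Irrational ξ) : (⌊(Int.fract ξ)⁻¹⌋ : ℝ) ≤ A := by
  have h0 : Int.fract ξ ≠ 0 := by
    intro h0
    exact hξ ⟨(⌊ξ⌋ : ℤ), by push_cast; linarith [Int.fract_add_floor ξ]⟩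
  refine h 0 _ ?_
  have := GenContFract.of_s_head h0
  rw [GenContFract.partDens, Stream'.Seq.map_get?]
  change Option.map _ (Stream'.Seq.head _) = _
  rw [this]
  rfl

theorem irrational_fract {ξ : ℝ} (hξ : Irrational ξ) : Irrational (Int.fract ξ) := by
  rw [Int.fract]
  exact hξ.sub_intCast _

theorem irrational_inv_fract {ξ : ℝ} (hξ : Irrational ξ) : Irrational (Int.fract ξ)⁻¹ :=
  irrational_inv_iff.2 (irrational_fract hξ)

theorem fract_pos_of_irrational {ξ : ℝ} (hξ : Irrational ξ) : 0 < Int.fract ξ :=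
  lt_of_le_of_ne (Int.fract_nonneg ξ) (irrational_fract hξ).ne_zero.symm

theorem PartialQuotientsLE.le_fract {A ξ : ℝ} (h : PartialQuotientsLE A ξ) (hξ : Irrational ξ) :
    1 / (A + 1) ≤ Int.fract ξ := by
  have h0 := fract_pos_of_irrational hξ
  have h1 := h.floor_inv_fract_le hξ
  have h2 := Int.lt_floor_add_one (Int.fract ξ)⁻¹
  have h3 : (Int.fract ξ)⁻¹ ≤ A + 1 := by linarith
  rw [one_div]
  exact inv_le_of_inv_le₀ h0 h3

theorem one_le_floor_inv_fract {ξ : ℝ} (hξ : Irrational ξ) : 1 ≤ ⌊(Int.fract ξ)⁻¹⌋ := by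
  have h0 := fract_pos_of_irrational hξ
  rw [Int.le_floor]
  push_cast
  exact (one_le_inv₀ h0).2 (Int.fract_lt_one ξ).le

theorem PartialQuotientsLE.le_one_sub_fract {A ξ : ℝ} (h : PartialQuotientsLE A ξ)
    (hξ : Irrational ξ) : 1 / (2 * (A + 1)) ≤ 1 - Int.fract ξ := by
  have h0 := fract_pos_of_irrational hξ
  have ha : (1 : ℝ) ≤ ⌊(Int.fract ξ)⁻¹⌋ := by exact_mod_cast one_le_floor_inv_fract hξ
  have hA := h.floor_inv_fract_le hξ
  have hy := h.inv_fract.le_fract (irrational_inv_fract hξ)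
  have hy1 := Int.fract_lt_one (Int.fract ξ)⁻¹
  set x := Int.fract ξ
  have hxy : (⌊x⁻¹⌋ : ℝ) + Int.fract x⁻¹ = x⁻¹ := Int.floor_add_fract _
  set y := Int.fract x⁻¹
  have h2 : 1 + y ≤ x⁻¹ := by linarith
  have h3 : x * (1 + y) ≤ 1 := by
    calc x * (1 + y) ≤ x * x⁻¹ := by gcongr
      _ = 1 := mul_inv_cancel₀ h0.ne'
  have h4 : 1 / (2 * (A + 1)) = 1 / (A + 1) / 2 := by field_simp
  have hA1 : 1 / (A + 1) ≤ 1 := by rw [div_le_one (by linarith)]; linarith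
  rw [h4]
  set b := 1 / (A + 1)
  have hb0 : 0 ≤ b := by simp only [b]; have : 0 ≤ A + 1 := by linarith
                         positivity
  -- Here `(1 - b / 2) * (1 + b) ≥ 1` because `0 ≤ b ≤ 1`, while `x * (1 + y) ≤ 1`.
  by_contra! hlt
  have h5 : (1 - b / 2) * (1 + b) < x * (1 + y) :=
    mul_lt_mul (by linarith) (by linarith) (by linarith) h0.le
  nlinarith

/-- A lower bound for an indefinite binary form which is carried into itself by the steps of the
continued fraction algorithm. -/
theorem PartialQuotientsLE.form_lower_bound {A b : ℝ} (hb : b = 1 / (2 * (A + 1))) (hA : 1 ≤ A) :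
    ∀ (n : ℕ) (ξ θ : ℝ) (q p : ℤ), PartialQuotientsLE A ξ → Irrational ξ → 0 ≤ θ → θ ≤ 1 →
      q ≤ n → 1 ≤ q → 1 ≤ p →
      b ^ 2 / 2 * (1 + Int.fract ξ * θ) ≤ |q * Int.fract ξ - p| * (q + p * θ) := by
  have hb0 : 0 < b := by rw [hb]; positivity
  have hb1 : b ≤ 1 := by
    rw [hb, div_le_one (by positivity)]; linarith
  intro n
  induction n with
  | zero => intro ξ θ q p _ _ _ _ h1 h2; simp at h1; omega
  | succ n ih =>
    intro ξ θ q p h hξ hθ0 hθ1 hqn hq hp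
    have hx0 := fract_pos_of_irrational hξ
    have hx1 := Int.fract_lt_one ξ
    have hbx' := h.le_one_sub_fract hξ
    have ha := one_le_floor_inv_fract hξ
    have hξ' := irrational_inv_fract hξ
    have hyb := h.inv_fract.le_fract hξ'
    have hyb' := h.inv_fract.le_one_sub_fract hξ'
    have hxb := h.le_fract hξ
    have hy1 := Int.fract_lt_one (Int.fract ξ)⁻¹
    -- One Gauss step sends `(q, p)` to `(p, q - p * a)` and `θ` to `1 / (a + θ)`. Both the form and
    -- the normalizing factor `1 + x * θ` are multiples, by `x * (a + θ)`, of their new values, so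
    -- the constant survives. The induction is on `q`, replaced by `p < q`.
    have key := ih (Int.fract ξ)⁻¹ (1 / (⌊(Int.fract ξ)⁻¹⌋ + θ)) p (q - p * ⌊(Int.fract ξ)⁻¹⌋)
      h.inv_fract hξ'
    set x := Int.fract ξ
    have hxy : (⌊x⁻¹⌋ : ℝ) + Int.fract x⁻¹ = x⁻¹ := Int.floor_add_fract _
    set y := Int.fract x⁻¹
    set a := ⌊x⁻¹⌋
    have haR : (1 : ℝ) ≤ a := by exact_mod_cast ha
    have hqR : (1 : ℝ) ≤ q := by exact_mod_cast hq
    have hpR : (1 : ℝ) ≤ p := by exact_mod_cast hp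
    have hbb : 2 * b = 1 / (A + 1) := by rw [hb]; field_simp
    rw [← hb] at hbx' hyb'
    rw [← hbb] at hyb hxb
    have hpθ : 0 ≤ p * θ := by positivity
    have easy : b ^ 2 ≤ |q * x - p| →
        b ^ 2 / 2 * (1 + x * θ) ≤ |q * x - p| * (q + p * θ) := by
      intro h1
      have h2 : x * θ ≤ 1 := by nlinarith
      calc b ^ 2 / 2 * (1 + x * θ) ≤ b ^ 2 / 2 * (1 + 1) := by gcongr
        _ = b ^ 2 * 1 := by ring
        _ ≤ _ := by gcongr; linarith
    have hxinv : x * (a + y) = 1 := by rw [hxy]; exact mul_inv_cancel₀ hx0.ne'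
    rcases le_or_gt q p with hqp | hpq
    · apply easy
      have : (q : ℝ) ≤ p := by exact_mod_cast hqp
      rw [abs_sub_comm]
      refine le_trans ?_ (le_abs_self _)
      nlinarith
    have hform : q * x - p = - x * (p * y - (q - p * a : ℤ)) := by
      push_cast
      linear_combination (p : ℝ) * hxinv
    rcases le_or_gt (q - p * a) 0 with hp1 | hp1
    · apply easy
      have : ((q - p * a : ℤ) : ℝ) ≤ 0 := by exact_mod_cast hp1
      rw [hform, abs_mul, abs_neg, abs_of_pos hx0]
      calc b ^ 2 = b * b := by ring
        _ ≤ x * |p * y - (q - p * a : ℤ)| := by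
          gcongr
          · linarith
          · refine le_trans ?_ (le_abs_self _)
            nlinarith
    · have key := key (by positivity) (by rw [div_le_one (by linarith)]; linarith) (by omega) hp
        (by omega)
      rw [hform, abs_mul, abs_neg, abs_of_pos hx0]
      have hy0 : 0 ≤ y := Int.fract_nonneg _
      have haθ : 0 < (a : ℝ) + θ := by linarith
      have e1 : (1 + x * θ) = x * (a + θ) * (1 + y * (1 / (a + θ))) := by
        field_simp
        linear_combination (-1 : ℝ) * hxinv
      have e2 : (q + p * θ : ℝ) = (a + θ) * (p + ((q - p * a : ℤ) : ℝ) * (1 / (a + θ))) := by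
        push_cast
        field_simp
        ring
      rw [e1, e2]
      calc _ = x * (a + θ) * (b ^ 2 / 2 * (1 + y * (1 / (a + θ)))) := by ring
        _ ≤ x * (a + θ) * (|p * y - (q - p * a : ℤ)| *
            (p + ((q - p * a : ℤ) : ℝ) * (1 / (a + θ)))) := by gcongr
        _ = _ := by ring

/-! ### Orbits of rotations by badly approximable numbers. -/

/-- `α` is badly approximable with constant `c`. -/
def BadlyApproximableWith (c α : ℝ) : Prop :=
  ∀ (q : ℕ) (p : ℤ), 1 ≤ q → c / q ≤ |q * α - p|

theorem IsBoundedType.exists_badlyApproximableWith {ξ : ℝ} (h : IsBoundedType ξ)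
    (hξ : Irrational ξ) : ∃ c : ℝ, 0 < c ∧ BadlyApproximableWith c ξ := by
  obtain ⟨A, hA⟩ := h
  have h : PartialQuotientsLE A ξ := hA
  have hA1 : 1 ≤ A :=
    le_trans (by exact_mod_cast one_le_floor_inv_fract hξ) (h.floor_inv_fract_le hξ)
  obtain ⟨b, hb⟩ : ∃ b : ℝ, b = 1 / (2 * (A + 1)) := ⟨_, rfl⟩
  have hb0 : 0 < b := by rw [hb]; positivity
  have hb1 : b ≤ 1 := by
    rw [hb, div_le_one (by positivity)]; linarith
  refine ⟨b ^ 2 / 2, by positivity, fun q p hq => ?_⟩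
  have hqR : (1 : ℝ) ≤ q := by exact_mod_cast hq
  rw [div_le_iff₀ (by positivity)]
  have e : (q : ℝ) * ξ - p = q * Int.fract ξ - (p - q * ⌊ξ⌋ : ℤ) := by
    push_cast
    rw [Int.fract]; ring
  rw [e]
  have hx0 := fract_pos_of_irrational hξ
  have hxb := h.le_fract hξ
  have hbb : 2 * b = 1 / (A + 1) := by rw [hb]; field_simp
  rw [← hbb] at hxb
  rcases le_or_gt (p - q * ⌊ξ⌋) 0 with hp | hp
  · have : ((p - q * ⌊ξ⌋ : ℤ) : ℝ) ≤ 0 := by exact_mod_cast hp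
    have h1 : b ≤ |q * Int.fract ξ - (p - q * ⌊ξ⌋ : ℤ)| := by
      refine le_trans ?_ (le_abs_self _)
      nlinarith
    nlinarith
  · have := PartialQuotientsLE.form_lower_bound hb hA1 q ξ 0 q (p - q * ⌊ξ⌋) h hξ le_rfl
      zero_le_one le_rfl (by exact_mod_cast hq) (by omega)
    simpa using this

theorem BadlyApproximableWith.add_int {c α : ℝ} (h : BadlyApproximableWith c α) (m : ℤ) :
    BadlyApproximableWith c (α + m) := by
  intro q p hq
  have := h q (p - q * m) hq
  convert this using 2
  push_cast
  ring

/-- The first `N` points of an orbit of the rotation by a badly approximable number are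
`C / N`-dense. -/
theorem BadlyApproximableWith.exists_dense {c α : ℝ} (hc : 0 < c)
    (h : BadlyApproximableWith c α) (N : ℕ) (hN : 1 ≤ N) (u : ℝ) :
    ∃ (i : ℕ) (p : ℤ), 1 ≤ i ∧ i ≤ N ∧ u < i * α - p ∧ i * α - p < u + (2 + 1 / c) / N := by
  obtain ⟨r, hr, hrN⟩ := Real.exists_rat_abs_sub_le_and_den_le α (n := N) hN
  have hden : 1 ≤ r.den := r.pos
  have hdR : (1 : ℝ) ≤ r.den := by exact_mod_cast hden
  have hdR0 : (0 : ℝ) < r.den := by linarith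
  have hNR : (1 : ℝ) ≤ N := by exact_mod_cast hN
  have hrr : (r : ℝ) = r.num / r.den := Rat.cast_def r
  have hε : r.den * |α - r| < 1 / N := by
    calc r.den * |α - r| ≤ r.den * (1 / ((N + 1) * r.den)) := by gcongr
      _ = 1 / (N + 1) := by field_simp
      _ < 1 / N := by gcongr; linarith
  -- Bad approximability forces the denominator of the Dirichlet approximation to exceed `c * N`, so
  -- the multiples of `1 / r.den` are dense at scale `1 / N`.
  have hd : 1 / (r.den : ℝ) < 1 / c / N := by
    have h1 := h r.den r.num hden
    have h2 : (r.den : ℝ) * α - r.num = r.den * (α - r) := by rw [hrr]; field_simp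
    rw [h2, abs_mul, abs_of_pos hdR0] at h1
    have h3 := h1.trans_lt hε
    rw [div_lt_div_iff₀ hdR0 (by positivity)] at h3
    rw [div_div, div_lt_div_iff₀ hdR0 (by positivity)]
    linarith
  -- The margin `1 / N` absorbs the error `i * (α - r)` made in replacing `α` by `r`.
  set t : ℤ := ⌊(u + 1 / N) * r.den⌋ + 1 with ht
  have ht1 : u + 1 / N < t / r.den := by
    rw [lt_div_iff₀ hdR0, ht]; push_cast; exact Int.lt_floor_add_one _
  have ht2 : (t : ℝ) / r.den ≤ u + 1 / N + 1 / r.den := by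
    rw [← sub_le_iff_le_add, ← sub_div, div_le_iff₀ hdR0, ht]; push_cast
    simpa using Int.floor_le ((u + 1 / N) * r.den)
  obtain ⟨x, y, hxy⟩ : IsCoprime r.num (r.den : ℤ) := by
    rw [Int.isCoprime_iff_gcd_eq_one]
    exact r.reduced
  have hd0 : (0 : ℤ) < r.den := by exact_mod_cast hden
  -- `x` inverts `r.num` modulo `r.den`, so `k * r.num ≡ t`; the shift by one puts the
  -- representative in `[1, r.den]`, excluding `0`.
  set k : ℤ := (x * t - 1) % r.den + 1 with hk
  have hk1 : 1 ≤ k := by have := Int.emod_nonneg (x * t - 1) hd0.ne'; omega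
  have hk2 : k ≤ r.den := by have := Int.emod_lt_of_pos (x * t - 1) hd0; omega
  obtain ⟨p, hp⟩ : ∃ p : ℤ, k * r.num - p * r.den = t := by
    refine ⟨-(r.num * ((x * t - 1) / r.den)) - y * t, ?_⟩
    have := Int.emod_add_mul_ediv (x * t - 1) r.den
    linear_combination (r.num : ℤ) * this + t * hxy + r.num * hk
  obtain ⟨i, hi⟩ := Int.eq_ofNat_of_zero_le (by omega : 0 ≤ k)
  have hir : i ≤ r.den := by omega
  refine ⟨i, p, by omega, hir.trans hrN, ?_⟩
  have e : (i : ℝ) * α - p = t / r.den + i * (α - r) := by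
    have hp' : ((i : ℝ) * r.num - p * r.den) = t := by rw [hi] at hp; exact_mod_cast hp
    rw [← hp', hrr]
    field_simp
    ring
  have hiε : |i * (α - r)| < 1 / N := by
    rw [abs_mul, abs_of_nonneg (by positivity)]
    refine lt_of_le_of_lt ?_ hε
    gcongr
  rw [e]
  obtain ⟨h1, h2⟩ := abs_lt.1 hiε
  have h3 : (2 + 1 / c) / N = 1 / N + 1 / N + 1 / c / N := by ring
  constructor
  · linarith
  · rw [h3]; linarith

/-- A set of points of an interval of length `l` which are `η`-separated has at most `l / η + 1`
elements. -/
theorem card_le_of_separated {ι : Type*} (s : Finset ι) (θ : ι → ℝ) {η u l : ℝ} (hη : 0 < η)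
    (hl : 0 ≤ l) (hmem : ∀ i ∈ s, u ≤ θ i ∧ θ i ≤ u + l)
    (hsep : ∀ i ∈ s, ∀ j ∈ s, i ≠ j → η ≤ |θ i - θ j|) : (s.card : ℝ) ≤ l / η + 1 := by
  have h1 : s.card ≤ (Finset.range (⌊l / η⌋₊ + 1)).card := by
    -- Pigeonhole: each bin of length `η` contains at most one of the points.
    refine Finset.card_le_card_of_injOn (fun i => ⌊(θ i - u) / η⌋₊) ?_ ?_
    · intro i hi
      have := hmem i hi
      simp only [Finset.coe_range, Set.mem_Iio]
      refine Nat.lt_succ_of_le (Nat.floor_le_floor ?_)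
      gcongr
      linarith
    · intro i hi j hj hij
      by_contra hne
      have h2 := hsep i hi j hj hne
      have hi0 : 0 ≤ (θ i - u) / η := div_nonneg (by linarith [hmem i hi]) hη.le
      have hj0 : 0 ≤ (θ j - u) / η := div_nonneg (by linarith [hmem j hj]) hη.le
      have a1 := Nat.floor_le hi0
      have a2 := Nat.lt_floor_add_one ((θ i - u) / η)
      have b1 := Nat.floor_le hj0
      have b2 := Nat.lt_floor_add_one ((θ j - u) / η)
      simp only at hij
      rw [hij] at a1 a2
      have h3 : |(θ i - u) / η - (θ j - u) / η| < 1 := abs_lt.2 ⟨by linarith, by linarith⟩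
      rw [← sub_div, abs_div, abs_of_pos hη, div_lt_one hη] at h3
      have : θ i - u - (θ j - u) = θ i - θ j := by ring
      rw [this] at h3
      linarith
  rw [Finset.card_range] at h1
  have h2 : (s.card : ℝ) ≤ (⌊l / η⌋₊ : ℝ) + 1 := by exact_mod_cast h1
  have h3 := Nat.floor_le (div_nonneg hl hη.le)
  linarith

/-- The points `i * α - p` with different `0 ≤ i ≤ N` are `c / N`-separated. -/
theorem BadlyApproximableWith.separated {c α : ℝ} (hc : 0 < c) (h : BadlyApproximableWith c α)
    {N i j : ℕ} (hi : i ≤ N) (hj : j ≤ N) (hij : i ≠ j) (p q : ℤ) :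
    c / N ≤ |(i * α - p) - (j * α - q)| := by
  wlog hlt : i < j generalizing i j p q
  · rw [abs_sub_comm]
    exact this hj hi hij.symm q p (by omega)
  have h1 := h (j - i) (q - p) (by omega)
  have h0 : 0 < j - i := by omega
  have h0R : (0 : ℝ) < ((j - i : ℕ) : ℝ) := by exact_mod_cast h0
  have hle : ((j - i : ℕ) : ℝ) ≤ N := by exact_mod_cast (by omega : j - i ≤ N)
  calc c / N ≤ c / ((j - i : ℕ) : ℝ) := by gcongr
    _ ≤ _ := h1
    _ = _ := by
      rw [abs_sub_comm (i * α - p)]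
      congr 1
      push_cast [Nat.cast_sub hlt.le]
      ring

open Set Filter Topology

/-! ### Slopes of the power map -/

/-- The signed power map `y ↦ y |y| ^ (d - 1)`. -/
noncomputable def signedPow (d y : ℝ) : ℝ := y * |y| ^ (d - 1)

theorem signedPow_of_nonneg {d y : ℝ} (hd : 1 < d) (hy : 0 ≤ y) : signedPow d y = y ^ d := by
  rw [signedPow, abs_of_nonneg hy]
  rcases hy.eq_or_lt with rfl | hy
  · rw [zero_mul, Real.zero_rpow (by linarith)]
  · rw [← Real.rpow_one_add' hy.le (by linarith)]
    congr 1; ring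

theorem signedPow_neg (d y : ℝ) : signedPow d (-y) = - signedPow d y := by
  simp [signedPow]

theorem signedPow_sub_le_aux {d x y w : ℝ} (hd : 1 < d) (hx : 0 ≤ x) (hxy : x ≤ y) (hyw : y ≤ w) :
    y ^ d - x ^ d ≤ d * w ^ (d - 1) * (y - x) := by
  rcases hxy.eq_or_lt with rfl | hlt
  · simp
  have hy : 0 < y := hx.trans_lt hlt
  have h1 := one_add_mul_self_le_rpow_one_add (s := x / y - 1) (p := d)
    (by linarith [div_nonneg hx hy.le]) hd.le
  have h2 : (1 + (x / y - 1)) ^ d = x ^ d / y ^ d := by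
    rw [add_sub_cancel, Real.div_rpow hx hy.le]
  have hyd : 0 < y ^ d := Real.rpow_pos_of_pos hy d
  rw [h2, le_div_iff₀ hyd] at h1
  have h3 : y ^ d = y * y ^ (d - 1) := by
    rw [← Real.rpow_one_add' hy.le (by linarith)]; congr 1; ring
  have h4 : (1 + d * (x / y - 1)) * y ^ d = y ^ d - d * y ^ (d - 1) * (y - x) := by
    rw [h3]; field_simp; ring
  have h5 : y ^ (d - 1) ≤ w ^ (d - 1) := by gcongr
  calc y ^ d - x ^ d ≤ d * y ^ (d - 1) * (y - x) := by linarith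
    _ ≤ _ := by gcongr

theorem signedPow_sub_le {d x y w : ℝ} (hd : 1 < d) (hx : -w ≤ x) (hxy : x ≤ y) (hyw : y ≤ w) :
    signedPow d y - signedPow d x ≤ d * w ^ (d - 1) * (y - x) := by
  have h0 : (0 : ℝ) ^ d = 0 := Real.zero_rpow (by linarith)
  rcases le_total 0 x with h | h
  · rw [signedPow_of_nonneg hd h, signedPow_of_nonneg hd (h.trans hxy)]
    exact signedPow_sub_le_aux hd h hxy hyw
  have ex : signedPow d x = - (-x) ^ d := by
    rw [← signedPow_of_nonneg hd (by linarith : 0 ≤ -x), signedPow_neg, neg_neg]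
  rcases le_total 0 y with h' | h'
  · rw [ex, signedPow_of_nonneg hd h']
    have h1 := signedPow_sub_le_aux hd le_rfl h' hyw
    have h2 := signedPow_sub_le_aux hd le_rfl (by linarith : 0 ≤ -x) (by linarith : -x ≤ w)
    rw [h0] at h1 h2
    linarith
  · have ey : signedPow d y = - (-y) ^ d := by
      rw [← signedPow_of_nonneg hd (by linarith : 0 ≤ -y), signedPow_neg, neg_neg]
    rw [ex, ey]
    have h2 := signedPow_sub_le_aux hd (by linarith : 0 ≤ -y) (by linarith : -y ≤ -x)
      (by linarith : -x ≤ w)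
    linarith

theorem le_signedPow_sub_aux {d u v : ℝ} (hd : 1 < d) (hv : 0 ≤ v) (huv : |u| ≤ v) :
    v ^ (d - 1) / 2 * (v - u) ≤ signedPow d v - signedPow d u := by
  have ev : v ^ d = v * v ^ (d - 1) := by
    rw [← Real.rpow_one_add' hv (by linarith)]; congr 1; ring
  have hp : 0 ≤ v ^ (d - 1) := Real.rpow_nonneg hv _
  rw [signedPow_of_nonneg hd hv, ev]
  have hle : |u| ^ (d - 1) ≤ v ^ (d - 1) := by
    gcongr
  have hp' : 0 ≤ |u| ^ (d - 1) := by positivity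
  rw [signedPow]
  rcases le_total 0 u with h | h
  · rw [abs_of_nonneg h] at *
    nlinarith
  · rw [abs_of_nonpos h] at *
    nlinarith

/-- The average slope of the signed power map on an interval bounds its average slopes on the
subintervals. -/
theorem slope_signedPow_le {d u v x y : ℝ} (hd : 1 < d) (hux : u ≤ x) (hxy : x < y) (hyv : y ≤ v) :
    slope (signedPow d) x y ≤ 2 * d * slope (signedPow d) u v := by
  -- `w` is the larger of `|u|` and `|v|`. All slopes inside are at most `d * w ^ (d - 1)`, and that
  -- of the whole interval is at least half of `w ^ (d - 1)`.
  obtain ⟨w, hw, hx, hy, h⟩ : ∃ w : ℝ, 0 ≤ w ∧ -w ≤ x ∧ y ≤ w ∧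
      w ^ (d - 1) / 2 * (v - u) ≤ signedPow d v - signedPow d u := by
    rcases le_total 0 (u + v) with h | h
    · exact ⟨v, by linarith, by linarith, hyv, le_signedPow_sub_aux hd (by linarith)
        (abs_le.2 ⟨by linarith, by linarith⟩)⟩
    · refine ⟨-u, by linarith, by linarith, by linarith, ?_⟩
      have := le_signedPow_sub_aux (d := d) (u := -v) (v := -u) hd (by linarith)
        (abs_le.2 ⟨by linarith, by linarith⟩)
      rw [signedPow_neg, signedPow_neg] at this
      linarith
  have h2 := signedPow_sub_le hd hx hxy.le hy
  rw [slope_def_field, slope_def_field]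
  have e1 : (signedPow d y - signedPow d x) / (y - x) ≤ d * w ^ (d - 1) := by
    rw [div_le_iff₀ (by linarith)]; exact h2
  have e2 : w ^ (d - 1) / 2 ≤ (signedPow d v - signedPow d u) / (v - u) := by
    rw [le_div_iff₀ (by linarith)]; exact h
  calc _ ≤ _ := e1
    _ = 2 * d * (w ^ (d - 1) / 2) := by ring
    _ ≤ _ := by gcongr

/-! ### Contraction of cross-ratios by power maps -/

/-- The quotient `sinh (d * x) / sinh x` increases on `x > 0`: the numerator of its derivative
vanishes at `0` and has derivative `(d ^ 2 - 1) * sinh (d * x) * sinh x ≥ 0`. -/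
theorem sinh_mul_sinh_le {d s t : ℝ} (hd : 1 ≤ d) (hs : 0 ≤ s) (hst : s ≤ t) :
    Real.sinh (d * s) * Real.sinh t ≤ Real.sinh (d * t) * Real.sinh s := by
  have hderiv (x : ℝ) : HasDerivAt (fun x => d * Real.cosh (d * x) * Real.sinh x
      - Real.sinh (d * x) * Real.cosh x) ((d ^ 2 - 1) * Real.sinh (d * x) * Real.sinh x) x := by
    have h1 : HasDerivAt (fun x : ℝ => d * x) d x := by simpa using (hasDerivAt_id x).const_mul d
    have h2 := ((h1.cosh.const_mul d).mul (Real.hasDerivAt_sinh x)).sub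
      (h1.sinh.mul (Real.hasDerivAt_cosh x))
    refine h2.congr_deriv ?_
    ring
  have hnonneg : ∀ x : ℝ, 0 ≤ x →
      0 ≤ d * Real.cosh (d * x) * Real.sinh x - Real.sinh (d * x) * Real.cosh x := by
    have hmono : MonotoneOn (fun x => d * Real.cosh (d * x) * Real.sinh x
        - Real.sinh (d * x) * Real.cosh x) (Ici 0) := by
      refine monotoneOn_of_deriv_nonneg (convex_Ici 0)
        (fun x _ => (hderiv x).continuousAt.continuousWithinAt)
        (fun x _ => (hderiv x).differentiableAt.differentiableWithinAt) ?_
      intro x hx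
      rw [interior_Ici, mem_Ioi] at hx
      rw [(hderiv x).deriv]
      have h1 : 0 ≤ Real.sinh (d * x) := Real.sinh_nonneg_iff.2 (by positivity)
      have h2 : 0 ≤ Real.sinh x := Real.sinh_nonneg_iff.2 hx.le
      have h3 : 0 ≤ d ^ 2 - 1 := by nlinarith
      positivity
    intro x hx
    have := hmono (mem_Ici.2 le_rfl) (mem_Ici.2 hx) hx
    simpa using this
  rcases hs.eq_or_lt with rfl | hs
  · simp
  have hmono : MonotoneOn (fun x => Real.sinh (d * x) / Real.sinh x) (Ioi 0) := by
    have hne : ∀ x ∈ Ioi (0 : ℝ), 0 < Real.sinh x := fun x hx => Real.sinh_pos_iff.2 hx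
    have hder : ∀ x ∈ Ioi (0 : ℝ), HasDerivAt (fun x => Real.sinh (d * x) / Real.sinh x)
        ((d * Real.cosh (d * x) * Real.sinh x - Real.sinh (d * x) * Real.cosh x)
          / Real.sinh x ^ 2) x := by
      intro x hx
      have h1 : HasDerivAt (fun x : ℝ => d * x) d x := by
        simpa using (hasDerivAt_id x).const_mul d
      refine (h1.sinh.div (Real.hasDerivAt_sinh x) (hne x hx).ne').congr_deriv ?_
      ring
    refine monotoneOn_of_deriv_nonneg (convex_Ioi 0)
      (fun x hx => (hder x hx).continuousAt.continuousWithinAt)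
      (fun x hx => (hder x (interior_subset hx)).differentiableAt.differentiableWithinAt) ?_
    intro x hx
    rw [interior_Ioi] at hx
    rw [(hder x hx).deriv]
    exact div_nonneg (hnonneg x (le_of_lt hx)) (sq_nonneg _)
  have := hmono hs (hs.trans_le hst) hst
  simp only at this
  rwa [div_le_div_iff₀ (Real.sinh_pos_iff.2 hs) (Real.sinh_pos_iff.2 (hs.trans_le hst))] at this

theorem exp_sub_exp (x y : ℝ) :
    Real.exp y - Real.exp x = 2 * Real.exp ((x + y) / 2) * Real.sinh ((y - x) / 2) := by
  rw [Real.sinh_eq]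
  have h1 : Real.exp y = Real.exp ((x + y) / 2) * Real.exp ((y - x) / 2) := by
    rw [← Real.exp_add]; congr 1; ring
  have h2 : Real.exp x = Real.exp ((x + y) / 2) * Real.exp (-((y - x) / 2)) := by
    rw [← Real.exp_add]; congr 1; ring
  rw [h1, h2]; ring

/-- In logarithmic coordinates differences become hyperbolic sines times exponentials of midpoints.
The exponentials cancel in cross-ratios, leaving two instances of `sinh_mul_sinh_le`. -/
theorem rpow_crossRatio_le {d a b c e : ℝ} (hd : 1 < d) (ha : 0 < a) (hab : a < b) (hbc : b < c)
    (hce : c < e) :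
    ((b ^ d - a ^ d) * (e ^ d - c ^ d)) * ((c - a) * (e - b)) ≤
      ((c ^ d - a ^ d) * (e ^ d - b ^ d)) * ((b - a) * (e - c)) := by
  obtain ⟨a, rfl⟩ : ∃ x, a = Real.exp x := ⟨Real.log a, (Real.exp_log ha).symm⟩
  obtain ⟨b, rfl⟩ : ∃ x, b = Real.exp x := ⟨Real.log b, (Real.exp_log (ha.trans hab)).symm⟩
  obtain ⟨c, rfl⟩ : ∃ x, c = Real.exp x :=
    ⟨Real.log c, (Real.exp_log (ha.trans (hab.trans hbc))).symm⟩
  obtain ⟨e, rfl⟩ : ∃ x, e = Real.exp x :=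
    ⟨Real.log e, (Real.exp_log (ha.trans (hab.trans (hbc.trans hce)))).symm⟩
  rw [Real.exp_lt_exp] at hab hbc hce
  simp only [← Real.exp_mul, exp_sub_exp]
  have r (x y : ℝ) : (y * d - x * d) / 2 = d * ((y - x) / 2) := by ring
  simp only [r]
  have h1 := sinh_mul_sinh_le (d := d) (s := (b - a) / 2) (t := (c - a) / 2) hd.le (by linarith)
    (by linarith)
  have h2 := sinh_mul_sinh_le (d := d) (s := (e - c) / 2) (t := (e - b) / 2) hd.le (by linarith)
    (by linarith)
  have p1 : 0 ≤ Real.sinh (d * ((e - c) / 2)) * Real.sinh ((e - b) / 2) :=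
    mul_nonneg (Real.sinh_nonneg_iff.2 (mul_nonneg (by linarith) (by linarith)))
      (Real.sinh_nonneg_iff.2 (by linarith))
  have p2 : 0 ≤ Real.sinh (d * ((c - a) / 2)) * Real.sinh ((b - a) / 2) :=
    mul_nonneg (Real.sinh_nonneg_iff.2 (mul_nonneg (by linarith) (by linarith)))
      (Real.sinh_nonneg_iff.2 (by linarith))
  have h3 := mul_le_mul h1 h2 p1 p2
  have e1 : Real.exp ((a * d + b * d) / 2) * Real.exp ((c * d + e * d) / 2) =
      Real.exp ((a * d + c * d) / 2) * Real.exp ((b * d + e * d) / 2) := by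
    rw [← Real.exp_add, ← Real.exp_add]; congr 1; ring
  have e2 : Real.exp ((a + b) / 2) * Real.exp ((c + e) / 2) =
      Real.exp ((a + c) / 2) * Real.exp ((b + e) / 2) := by
    rw [← Real.exp_add, ← Real.exp_add]; congr 1; ring
  calc _ = 16 * (Real.exp ((a * d + b * d) / 2) * Real.exp ((c * d + e * d) / 2)) *
        (Real.exp ((a + c) / 2) * Real.exp ((b + e) / 2)) *
        (Real.sinh (d * ((b - a) / 2)) * Real.sinh ((c - a) / 2) *
          (Real.sinh (d * ((e - c) / 2)) * Real.sinh ((e - b) / 2))) := by ring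
    _ ≤ 16 * (Real.exp ((a * d + b * d) / 2) * Real.exp ((c * d + e * d) / 2)) *
        (Real.exp ((a + c) / 2) * Real.exp ((b + e) / 2)) *
        (Real.sinh (d * ((c - a) / 2)) * Real.sinh ((b - a) / 2) *
          (Real.sinh (d * ((e - b) / 2)) * Real.sinh ((e - c) / 2))) := by gcongr
    _ = _ := by rw [e1, ← e2]; ring

/-- Away from the origin, the signed power map contracts cross-ratios. -/
theorem slope_signedPow_mul_le {d a b c e : ℝ} (hd : 1 < d) (hab : a < b) (hbc : b < c)
    (hce : c < e) (h0 : 0 < a ∨ e < 0) :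
    slope (signedPow d) a b * slope (signedPow d) c e ≤
      slope (signedPow d) a c * slope (signedPow d) b e := by
  simp only [slope_def_field]
  rw [div_mul_div_comm, div_mul_div_comm, div_le_div_iff₀ (mul_pos (by linarith) (by linarith))
    (mul_pos (by linarith) (by linarith))]
  rcases h0 with h0 | h0
  · simp only [signedPow_of_nonneg hd h0.le, signedPow_of_nonneg hd (h0.trans hab).le,
      signedPow_of_nonneg hd (h0.trans (hab.trans hbc)).le,
      signedPow_of_nonneg hd (h0.trans (hab.trans (hbc.trans hce))).le]
    exact rpow_crossRatio_le hd h0 hab hbc hce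
  · have r {x : ℝ} (hx : x < 0) : signedPow d x = -(-x) ^ d := by
      rw [← signedPow_of_nonneg hd (by linarith : 0 ≤ -x), signedPow_neg, neg_neg]
    rw [r h0, r (hce.trans h0), r (hbc.trans (hce.trans h0)),
      r (hab.trans (hbc.trans (hce.trans h0)))]
    have := rpow_crossRatio_le (d := d) (a := -e) (b := -c) (c := -b) (e := -a) hd
      (by linarith) (by linarith) (by linarith) (by linarith)
    linarith

/-! ### Distortion of diffeomorphisms -/

/-- Near a point where its derivative is positive, a `C^2` map has average slopes with bounded
distortion. -/
theorem exists_slope_distortion {φ : ℝ → ℝ} {U : Set ℝ} (hU : IsOpen U) (hφ : ContDiffOn ℝ 2 φ U)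
    {x₀ : ℝ} (hx₀ : x₀ ∈ U) (hpos : 0 < deriv φ x₀) :
    ∃ r K : ℝ, 0 < r ∧ 0 ≤ K ∧ ∀ w z u v u' v' : ℝ, x₀ - r < w → z < x₀ + r →
      w ≤ u → u < v → v ≤ z → w ≤ u' → u' < v' → v' ≤ z →
      0 < slope φ u v ∧ slope φ u' v' ≤ Real.exp (K * (z - w)) * slope φ u v := by
  have hd : ContDiffOn ℝ 1 (deriv φ) U := hφ.deriv_of_isOpen hU (by norm_num)
  have hdx : ContDiffAt ℝ 1 (deriv φ) x₀ := hd.contDiffAt (hU.mem_nhds hx₀)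
  -- Slopes are values of the derivative by the mean value theorem, so a Lipschitz constant of `log
  -- φ'` bounds the logarithm of their quotient.
  obtain ⟨K, t, ht, hK⟩ := (hdx.log hpos.ne').exists_lipschitzOnWith
  have hev : ∀ᶠ x in 𝓝 x₀, 0 < deriv φ x := hdx.continuousAt.eventually (lt_mem_nhds hpos)
  obtain ⟨r, hr, hball⟩ := Metric.eventually_nhds_iff_ball.1
    ((hev.and (hU.mem_nhds hx₀)).and ht)
  have hval : ∀ w z u v : ℝ, x₀ - r < w → z < x₀ + r → w ≤ u → u < v → v ≤ z →
      ∃ ξ, w ≤ ξ ∧ ξ ≤ z ∧ ξ ∈ Metric.ball x₀ r ∧ slope φ u v = deriv φ ξ := by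
    intro w z u v hw hz hwu huv hvz
    have hmem : ∀ x ∈ Icc u v, x ∈ Metric.ball x₀ r := by
      intro x hx
      rw [Real.ball_eq_Ioo]
      exact ⟨by linarith [hx.1], by linarith [hx.2]⟩
    have hdiff : ∀ x ∈ Icc u v, DifferentiableAt ℝ φ x := fun x hx =>
      (hφ.contDiffAt (hU.mem_nhds (hball x (hmem x hx)).1.2)).differentiableAt (by norm_num)
    obtain ⟨ξ, hξ, h⟩ := exists_deriv_eq_slope' φ huv
      (fun x hx => (hdiff x hx).continuousAt.continuousWithinAt)
      (fun x hx => (hdiff x (Ioo_subset_Icc_self hx)).differentiableWithinAt)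
    exact ⟨ξ, by linarith [hξ.1], by linarith [hξ.2], hmem ξ (Ioo_subset_Icc_self hξ), h.symm⟩
  refine ⟨r, K, hr, K.2, ?_⟩
  intro w z u v u' v' hw hz hwu huv hvz hwu' huv' hvz'
  obtain ⟨ξ, h1, h2, h3, h4⟩ := hval w z u v hw hz hwu huv hvz
  obtain ⟨ξ', h1', h2', h3', h4'⟩ := hval w z u' v' hw hz hwu' huv' hvz'
  rw [h4, h4']
  have p := (hball ξ h3).1.1
  have p' := (hball ξ' h3').1.1
  refine ⟨p, ?_⟩
  have hlip := hK.dist_le_mul ξ' (hball ξ' h3').2 ξ (hball ξ h3).2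
  rw [Real.dist_eq, Real.dist_eq] at hlip
  have h5 : |ξ' - ξ| ≤ z - w := abs_le.2 ⟨by linarith, by linarith⟩
  have h6 : Real.log (deriv φ ξ') ≤ K * (z - w) + Real.log (deriv φ ξ) := by
    have := (le_abs_self _).trans (hlip.trans (mul_le_mul_of_nonneg_left h5 K.2))
    linarith
  rw [← Real.exp_log p, ← Real.exp_log p', ← Real.exp_add]
  exact Real.exp_le_exp.2 h6

/-! ### Distortion of multicritical circle maps -/

/-- The cross-ratio of four points of the line. -/
noncomputable def crossRatio (a b c e : ℝ) : ℝ := (b - a) * (e - c) / ((c - a) * (e - b))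

theorem crossRatio_pos {a b c e : ℝ} (hab : a < b) (hbc : b < c) (hce : c < e) :
    0 < crossRatio a b c e := by
  rw [crossRatio]
  exact div_pos (mul_pos (by linarith) (by linarith)) (mul_pos (by linarith) (by linarith))

theorem slope_pos_of_strictMono {F : ℝ → ℝ} (hF : StrictMono F) {u v : ℝ} (h : u < v) :
    0 < slope F u v := by
  rw [slope_def_field]
  exact div_pos (by linarith [hF h]) (by linarith)

/-- The distortion of the cross-ratio is the quotient of the two products of slopes. -/
theorem crossRatio_comp_le {F : ℝ → ℝ} (hF : StrictMono F) {a b c e M : ℝ} (hab : a < b)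
    (hbc : b < c) (hce : c < e)
    (h : slope F a b * slope F c e ≤ M * (slope F a c * slope F b e)) :
    crossRatio (F a) (F b) (F c) (F e) ≤ M * crossRatio a b c e := by
  have h1 : 0 < slope F a c * slope F b e :=
    mul_pos (slope_pos_of_strictMono hF (hab.trans hbc)) (slope_pos_of_strictMono hF (hbc.trans hce))
  have e1 : crossRatio (F a) (F b) (F c) (F e) =
      crossRatio a b c e * (slope F a b * slope F c e / (slope F a c * slope F b e)) := by
    simp only [crossRatio, slope_def_field]
    have h1 := sub_pos.2 hab
    have h2 := sub_pos.2 hce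
    have h3 := sub_pos.2 (hab.trans hbc)
    have h4 := sub_pos.2 (hbc.trans hce)
    have h3' := sub_pos.2 (hF (hab.trans hbc))
    have h4' := sub_pos.2 (hF (hbc.trans hce))
    field_simp
  rw [e1, mul_comm]
  gcongr
  · exact (crossRatio_pos hab hbc hce).le
  · rwa [div_le_iff₀ h1]

/-- On intervals of length less than `δ` starting at a point of `s`, the map `F` has average slopes
which are dominated by those of larger intervals, and it has controlled cross-ratio distortion if
there is no critical point. -/
def DistortionOn (F : ℝ → ℝ) (C K δ : ℝ) (s : Set ℝ) : Prop :=
  ∀ u ∈ s, (∀ x y v, u ≤ x → x < y → y ≤ v → v < u + δ → slope F x y ≤ C * slope F u v) ∧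
    ∀ b c e, u < b → b < c → c < e → e < u + δ → (∀ x ∈ Icc u e, deriv F x ≠ 0) →
      slope F u b * slope F c e ≤ Real.exp (K * (e - u)) * (slope F u c * slope F b e)

theorem distortionOn_of_regular {F : ℝ → ℝ} (hC : ContDiff ℝ 3 F) {x₀ : ℝ}
    (hx₀ : 0 < deriv F x₀) : ∃ C K δ r : ℝ, 0 < C ∧ 0 ≤ K ∧ 0 < δ ∧ 0 < r ∧
      DistortionOn F C K δ (Ioo (x₀ - r) (x₀ + r)) := by
  obtain ⟨r, K, hr, hK, h⟩ := exists_slope_distortion (φ := F) (x₀ := x₀) isOpen_univ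
    ((hC.of_le (by norm_num)).contDiffOn) (mem_univ _) hx₀
  refine ⟨Real.exp (K * (2 * r)), 2 * K, r / 2, r / 2, Real.exp_pos _, by positivity, by positivity,
    by positivity, ?_⟩
  rintro u ⟨hu1, hu2⟩
  constructor
  · intro x y v hux hxy hyv hv
    obtain ⟨h1, h2⟩ := h u v u v x y (by linarith) (by linarith) le_rfl (by linarith) le_rfl hux hxy
      hyv
    refine h2.trans ?_
    gcongr
    linarith
  · intro b c e hub hbc hce he _
    obtain ⟨h1, h2⟩ := h u e u c u b (by linarith) (by linarith) le_rfl (by linarith) (by linarith)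
      le_rfl hub (by linarith)
    obtain ⟨h3, h4⟩ := h u e b e c e (by linarith) (by linarith) (by linarith) (by linarith) le_rfl
      (by linarith) hce le_rfl
    have h5 := (h u e c e c e (by linarith) (by linarith) (by linarith) (by linarith) le_rfl
      (by linarith) hce le_rfl).1
    calc _ ≤ (Real.exp (K * (e - u)) * slope F u c) * (Real.exp (K * (e - u)) * slope F b e) := by
          gcongr
      _ = (Real.exp (K * (e - u)) * Real.exp (K * (e - u))) * (slope F u c * slope F b e) := by ring
      _ = _ := by rw [← Real.exp_add]; congr 2; ring

theorem signedPow_pos_iff {d y : ℝ} : 0 < signedPow d y ↔ 0 < y := by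
  rw [signedPow]
  constructor
  · intro h
    by_contra! hy
    have : 0 ≤ |y| ^ (d - 1) := by positivity
    nlinarith
  · intro h
    have : 0 < |y| ^ (d - 1) := Real.rpow_pos_of_pos (abs_pos.2 h.ne') _
    positivity

/-- The derivative is nonzero because `φ` has a differentiable inverse, and nonnegative because `F`
increases and `signedPow` preserves signs. -/
theorem deriv_pos_of_nonFlat {F : ℝ → ℝ} (hF : StrictMono F) {x₀ d : ℝ}
    {φ : OpenPartialHomeomorph ℝ ℝ} (hx₀ : x₀ ∈ φ.source) (hφ0 : φ x₀ = 0)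
    (h1 : ContDiffOn ℝ 3 φ φ.source) (h2 : ContDiffOn ℝ 3 φ.symm φ.target)
    (hFφ : ∀ x ∈ φ.source, F x = F x₀ + φ x * |φ x| ^ (d - 1)) : 0 < deriv φ x₀ := by
  have hd1 : DifferentiableAt ℝ φ x₀ :=
    (h1.contDiffAt (φ.open_source.mem_nhds hx₀)).differentiableAt (by norm_num)
  have hd2 : DifferentiableAt ℝ φ.symm (φ x₀) :=
    (h2.contDiffAt (φ.open_target.mem_nhds (φ.map_source hx₀))).differentiableAt (by norm_num)
  have hne : deriv φ x₀ ≠ 0 := by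
    intro h0
    have hc : HasDerivAt (φ.symm ∘ φ) (deriv φ.symm (φ x₀) * deriv φ x₀) x₀ :=
      hd2.hasDerivAt.comp x₀ hd1.hasDerivAt
    have hid : (φ.symm ∘ φ) =ᶠ[𝓝 x₀] id :=
      Filter.eventually_of_mem (φ.open_source.mem_nhds hx₀) fun x hx => φ.left_inv hx
    have := hc.unique ((hasDerivAt_id x₀).congr_of_eventuallyEq hid)
    rw [h0, mul_zero] at this
    exact zero_ne_one this
  refine lt_of_le_of_ne ?_ hne.symm
  have ht := (hasDerivAt_iff_tendsto_slope.1 hd1.hasDerivAt)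
  have ht' : Tendsto (slope φ x₀) (𝓝[>] x₀) (𝓝 (deriv φ x₀)) :=
    ht.mono_left (nhdsWithin_mono _ fun x hx => ne_of_gt hx)
  refine ge_of_tendsto ht' ?_
  filter_upwards [self_mem_nhdsWithin, mem_nhdsWithin_of_mem_nhds (φ.open_source.mem_nhds hx₀)]
    with x hx hxs
  rw [slope_def_field, hφ0, sub_zero]
  have h3 := hFφ x hxs
  have h4 : 0 < signedPow d (φ x) := by
    rw [signedPow]; linarith [hF hx]
  exact div_nonneg (signedPow_pos_iff.1 h4).le (by linarith [mem_Ioi.1 hx])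

theorem slope_comp_eq {P φ F : ℝ → ℝ} {k u v : ℝ} (hu : F u = k + P (φ u)) (hv : F v = k + P (φ v))
    (huv : φ u ≠ φ v) : slope F u v = slope P (φ u) (φ v) * slope φ u v := by
  simp only [slope_def_field]
  have : φ v - φ u ≠ 0 := sub_ne_zero.2 huv.symm
  rw [hu, hv, div_mul_div_comm, mul_comm (φ v - φ u), mul_div_mul_right _ _ this]
  ring

theorem distortionOn_of_critical {F : ℝ → ℝ} (hF : StrictMono F) {x₀ d : ℝ}
    (hx₀ : IsNonFlatCriticalPoint F x₀ d) : ∃ C K δ r : ℝ, 0 < C ∧ 0 ≤ K ∧ 0 < δ ∧ 0 < r ∧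
      DistortionOn F C K δ (Ioo (x₀ - r) (x₀ + r)) := by
  obtain ⟨hcrit, hd, φ, hxs, hφ0, hφ, hφ', hFφ⟩ := hx₀
  have hpos := deriv_pos_of_nonFlat hF hxs hφ0 hφ hφ' hFφ
  obtain ⟨r₁, K, hr₁, hK, h⟩ := exists_slope_distortion φ.open_source (hφ.of_le (by norm_num)) hxs
    hpos
  obtain ⟨r₂, hr₂, hball⟩ := Metric.isOpen_iff.1 φ.open_source x₀ hxs
  obtain ⟨r, hr, hrr₁, hrr₂⟩ : ∃ r : ℝ, 0 < r ∧ r ≤ r₁ ∧ r ≤ r₂ :=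
    ⟨min r₁ r₂, lt_min hr₁ hr₂, min_le_left _ _, min_le_right _ _⟩
  rw [Real.ball_eq_Ioo] at hball
  have hF' : ∀ x, x₀ - r < x → x < x₀ + r → F x = F x₀ + signedPow d (φ x) := fun x h1 h2 =>
    hFφ x (hball ⟨by linarith, by linarith⟩)
  have hpos' : ∀ u v, x₀ - r < u → u < v → v < x₀ + r → 0 < slope φ u v := fun u v h1 h2 h3 =>
    (h u v u v u v (by linarith) (by linarith) le_rfl h2 le_rfl le_rfl h2 le_rfl).1
  have hmono : ∀ u v, x₀ - r < u → u < v → v < x₀ + r → φ u < φ v := by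
    intro u v h1 h2 h3
    have := hpos' u v h1 h2 h3
    rw [slope_def_field, div_pos_iff_of_pos_right (by linarith)] at this
    linarith
  have hmono' : ∀ u v, x₀ - r < u → u ≤ v → v < x₀ + r → φ u ≤ φ v := by
    intro u v h1 h2 h3
    rcases h2.eq_or_lt with rfl | h2
    · rfl
    · exact (hmono u v h1 h2 h3).le
  have hslope : ∀ u v, x₀ - r < u → u < v → v < x₀ + r →
      slope F u v = slope (signedPow d) (φ u) (φ v) * slope φ u v := fun u v h1 h2 h3 =>
    slope_comp_eq (hF' u h1 (by linarith)) (hF' v (by linarith) h3) (hmono u v h1 h2 h3).ne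
  have hPpos : ∀ u v, x₀ - r < u → u < v → v < x₀ + r →
      0 < slope (signedPow d) (φ u) (φ v) := by
    intro u v h1 h2 h3
    have h4 := slope_pos_of_strictMono hF h2
    rw [hslope u v h1 h2 h3] at h4
    exact (pos_iff_pos_of_mul_pos h4).2 (hpos' u v h1 h2 h3)
  -- The factor `2 * d` comes from the power map and the exponential from `φ`. `K` is doubled
  -- because two slopes of `φ` are compared, and `r` is halved so that the intervals stay within `r`
  -- of `x₀`.
  refine ⟨2 * d * Real.exp (K * (2 * r)), 2 * K, r / 2, r / 2, by positivity, by positivity,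
    by positivity, by positivity, ?_⟩
  rintro u ⟨hu1, hu2⟩
  constructor
  · intro x y v hux hxy hyv hv
    obtain ⟨h1, h2⟩ := h u v u v x y (by linarith) (by linarith) le_rfl (by linarith) le_rfl hux hxy
      hyv
    rw [hslope x y (by linarith) hxy (by linarith), hslope u v (by linarith) (by linarith)
      (by linarith)]
    have h3 := slope_signedPow_le hd (hmono' u x (by linarith) hux (by linarith))
      (hmono x y (by linarith) hxy (by linarith)) (hmono' y v (by linarith) hyv (by linarith))
    have h4 : slope φ x y ≤ Real.exp (K * (2 * r)) * slope φ u v := by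
      refine h2.trans ?_
      gcongr
      linarith
    have h5 := hPpos x y (by linarith) hxy (by linarith)
    calc _ ≤ (2 * d * slope (signedPow d) (φ u) (φ v)) *
          (Real.exp (K * (2 * r)) * slope φ u v) := by
          gcongr
          · exact (hpos' x y (by linarith) hxy (by linarith)).le
          · exact h5.le.trans h3
      _ = _ := by ring
  · intro b c e hub hbc hce he hnc
    -- Since `x₀` is critical it lies outside `[u, e]`, so the image under `φ` stays on one side of
    -- the origin, where the power map contracts cross-ratios.
    have h0 : 0 < φ u ∨ φ e < 0 := by
      rw [← hφ0]
      by_contra! hcon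
      have h1 : u ≤ x₀ := by
        by_contra! hlt
        exact absurd (hmono x₀ u (by linarith) hlt (by linarith)) (not_lt.2 hcon.1)
      have h2 : x₀ ≤ e := by
        by_contra! hlt
        exact absurd (hmono e x₀ (by linarith) hlt (by linarith)) (not_lt.2 hcon.2)
      exact hnc x₀ ⟨h1, h2⟩ hcrit
    obtain ⟨-, h2⟩ := h u e u c u b (by linarith) (by linarith) le_rfl (by linarith) (by linarith)
      le_rfl hub (by linarith)
    obtain ⟨-, h4⟩ := h u e b e c e (by linarith) (by linarith) (by linarith) (by linarith) le_rfl
      (by linarith) hce le_rfl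
    have h5 := slope_signedPow_mul_le hd (hmono u b (by linarith) hub (by linarith))
      (hmono b c (by linarith) hbc (by linarith)) (hmono c e (by linarith) hce (by linarith)) h0
    rw [hslope u b (by linarith) (by linarith) (by linarith),
      hslope c e (by linarith) (by linarith) (by linarith),
      hslope u c (by linarith) (by linarith) (by linarith),
      hslope b e (by linarith) (by linarith) (by linarith)]
    have q1 := hpos' c e (by linarith) hce (by linarith)
    have q2 := hpos' u b (by linarith) hub (by linarith)
    have q3 := hpos' u c (by linarith) (by linarith) (by linarith)
    have q4 := hPpos u c (by linarith) (by linarith) (by linarith)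
    have q5 := hPpos b e (by linarith) (by linarith) (by linarith)
    calc _ = (slope (signedPow d) (φ u) (φ b) * slope (signedPow d) (φ c) (φ e)) *
          (slope φ u b * slope φ c e) := by ring
      _ ≤ (slope (signedPow d) (φ u) (φ c) * slope (signedPow d) (φ b) (φ e)) *
          ((Real.exp (K * (e - u)) * slope φ u c) * (Real.exp (K * (e - u)) * slope φ b e)) := by
        gcongr
      _ = (Real.exp (K * (e - u)) * Real.exp (K * (e - u))) * (slope (signedPow d) (φ u) (φ c) *
          slope φ u c * (slope (signedPow d) (φ b) (φ e) * slope φ b e)) := by ring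
      _ = _ := by rw [← Real.exp_add]; congr 2; ring

/-! ### From local to global distortion bounds. -/

theorem DistortionOn.mono {F : ℝ → ℝ} {C K δ C' K' δ' : ℝ} {s t : Set ℝ} (hF : StrictMono F)
    (h : DistortionOn F C K δ s) (hC : C ≤ C') (hK : K ≤ K') (hδ : δ' ≤ δ) (hst : t ⊆ s) :
    DistortionOn F C' K' δ' t := by
  intro u hu
  obtain ⟨h1, h2⟩ := h u (hst hu)
  constructor
  · intro x y v hux hxy hyv hv
    refine (h1 x y v hux hxy hyv (by linarith)).trans ?_
    have := (slope_pos_of_strictMono hF (by linarith : u < v)).le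
    gcongr
  · intro b c e hub hbc hce he hcr
    refine (h2 b c e hub hbc hce (by linarith) hcr).trans ?_
    have := (slope_pos_of_strictMono hF (by linarith : u < c)).le
    have := (slope_pos_of_strictMono hF (by linarith : b < e)).le
    have : 0 ≤ e - u := by linarith
    gcongr

theorem exists_distortionOn_Icc {F : ℝ → ℝ} (hF : StrictMono F) (hC : ContDiff ℝ 3 F)
    (hcr : ∀ c : ℝ, deriv F c = 0 → ∃ d : ℝ, IsNonFlatCriticalPoint F c d) :
    ∃ C K δ : ℝ, 0 < C ∧ 0 ≤ K ∧ 0 < δ ∧ DistortionOn F C K δ (Icc 0 1) := by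
  -- Compactness: the property passes to subsets and to finite unions, and it holds near each point,
  -- regular or critical.
  refine isCompact_Icc.induction_on (p := fun s => ∃ C K δ : ℝ, 0 < C ∧ 0 ≤ K ∧ 0 < δ ∧
    DistortionOn F C K δ s) ⟨1, 0, 1, one_pos, le_rfl, one_pos, fun u hu => hu.elim⟩ ?_ ?_ ?_
  · rintro s t hst ⟨C, K, δ, h1, h2, h3, h⟩
    exact ⟨C, K, δ, h1, h2, h3, h.mono hF le_rfl le_rfl le_rfl hst⟩
  · rintro s t ⟨C, K, δ, h1, h2, h3, h⟩ ⟨C', K', δ', h1', h2', h3', h'⟩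
    refine ⟨max C C', max K K', min δ δ', lt_max_of_lt_left h1, le_max_of_le_left h2,
      lt_min h3 h3', ?_⟩
    rintro u (hu | hu)
    · exact h.mono hF (le_max_left _ _) (le_max_left _ _) (min_le_left _ _) Subset.rfl u hu
    · exact h'.mono hF (le_max_right _ _) (le_max_right _ _) (min_le_right _ _) Subset.rfl u hu
  · intro x _
    have key : ∃ C K δ r : ℝ, 0 < C ∧ 0 ≤ K ∧ 0 < δ ∧ 0 < r ∧
        DistortionOn F C K δ (Ioo (x - r) (x + r)) := by
      rcases (hF.monotone.deriv_nonneg (x := x)).eq_or_lt with h | h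
      · obtain ⟨d, hd⟩ := hcr x h.symm
        exact distortionOn_of_critical hF hd
      · exact distortionOn_of_regular hC h
    obtain ⟨C, K, δ, r, h1, h2, h3, hr, h⟩ := key
    exact ⟨_, mem_nhdsWithin_of_mem_nhds (Ioo_mem_nhds (by linarith) (by linarith)),
      C, K, δ, h1, h2, h3, h⟩

theorem slope_add_int (F : CircleDeg1Lift) (x y : ℝ) (m : ℤ) :
    slope F (x + m) (y + m) = slope F x y := by
  simp only [slope_def_field, CircleDeg1Lift.map_add_int]
  congr 1 <;> ring

theorem deriv_add_int (F : CircleDeg1Lift) (x : ℝ) (m : ℤ) : deriv F (x + m) = deriv F x := by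
  rw [← deriv_comp_add_const (f := F)]
  simp only [CircleDeg1Lift.map_add_int]
  rw [deriv_add_const]

theorem DistortionOn.to_univ {F : CircleDeg1Lift} {C K δ : ℝ} (h : DistortionOn F C K δ (Icc 0 1)) :
    DistortionOn F C K δ univ := by
  intro u _
  have e1 (x : ℝ) : x = Int.fract u + (x - u) + (⌊u⌋ : ℤ) := by
    rw [Int.fract]; ring
  obtain ⟨h1, h2⟩ := h (Int.fract u) ⟨Int.fract_nonneg u, (Int.fract_lt_one u).le⟩
  have hu : u = Int.fract u + (⌊u⌋ : ℤ) := (Int.fract_add_floor u).symm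
  constructor
  · intro x y v hux hxy hyv hv
    have := h1 (Int.fract u + (x - u)) (Int.fract u + (y - u)) (Int.fract u + (v - u))
      (by linarith) (by linarith) (by linarith) (by linarith)
    rw [← slope_add_int F _ _ ⌊u⌋, ← slope_add_int F (Int.fract u) _ ⌊u⌋, ← e1, ← e1, ← e1,
      ← hu] at this
    exact this
  · intro b c e hub hbc hce he hcr
    have := h2 (Int.fract u + (b - u)) (Int.fract u + (c - u)) (Int.fract u + (e - u))
      (by linarith) (by linarith) (by linarith) (by linarith) (by
        intro x hx
        rw [← deriv_add_int F x ⌊u⌋]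
        refine hcr _ ⟨?_, ?_⟩
        · linarith [hx.1]
        · have := e1 e
          linarith [hx.2])
    rw [← slope_add_int F (Int.fract u) (Int.fract u + (b - u)) ⌊u⌋,
      ← slope_add_int F _ (Int.fract u + (e - u)) ⌊u⌋,
      ← slope_add_int F (Int.fract u) (Int.fract u + (c - u)) ⌊u⌋,
      ← slope_add_int F (Int.fract u + (b - u)) _ ⌊u⌋, ← e1, ← e1, ← e1, ← hu] at this
    have e2 : Int.fract u + (e - u) - Int.fract u = e - u := by ring
    rwa [e2] at this

/-- The average slopes on the intervals of length at most one dominate those on their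
subintervals. -/
theorem DistortionOn.exists_slope_le {F : CircleDeg1Lift} {C K δ : ℝ} (hF : StrictMono F)
    (hFc : Continuous F) (hC : 0 < C) (hδ : 0 < δ) (h : DistortionOn F C K δ univ) :
    ∃ D : ℝ, 0 < D ∧ ∀ u x y v : ℝ, u ≤ x → x < y → y ≤ v → v ≤ u + 1 →
      slope F x y ≤ D * slope F u v := by
  obtain ⟨η, hη, hηδ, hη1⟩ : ∃ η : ℝ, 0 < η ∧ η < δ ∧ η < 1 :=
    ⟨min δ 1 / 2, by positivity, by
      have := min_le_left δ 1
      have : 0 < min δ 1 := by positivity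
      linarith, by
      have := min_le_right δ 1
      have : 0 < min δ 1 := by positivity
      linarith⟩
  have hinc : ∀ x y : ℝ, y ≤ x + 1 → F y - F x ≤ 1 := by
    intro x y hxy
    have := F.monotone hxy
    rw [F.map_add_one] at this
    linarith
  obtain ⟨μ, hμ, hμF⟩ : ∃ μ : ℝ, 0 < μ ∧ ∀ u : ℝ, μ ≤ F (u + η) - F u := by
    obtain ⟨z, -, hz⟩ := isCompact_Icc.exists_isMinOn (s := Icc (0 : ℝ) 1)
      (nonempty_Icc.2 zero_le_one) (f := fun u => F (u + η) - F u)
      (by fun_prop)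
    refine ⟨F (z + η) - F z, by linarith [hF (by linarith : z < z + η)], fun u => ?_⟩
    have h1 := hz ⟨Int.fract_nonneg u, (Int.fract_lt_one u).le⟩
    simp only [mem_ofPred_eq] at h1
    have e : F (u + η) - F u = F (Int.fract u + η) - F (Int.fract u) := by
      have e1 : u = Int.fract u + (⌊u⌋ : ℤ) := (Int.fract_add_floor u).symm
      have e2 : u + η = Int.fract u + η + (⌊u⌋ : ℤ) := by linarith
      rw [e2]
      nth_rw 3 [e1]
      rw [F.map_add_int, F.map_add_int]
      ring
    rw [e]; exact h1
  have hup : ∀ x y : ℝ, x < y → y ≤ x + 1 → slope F x y ≤ (C + 1) / η := by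
    intro x y hxy hyx
    rcases le_or_gt y (x + η) with hy | hy
    · have h1 := (h x (mem_univ _)).1 x y (x + η) le_rfl hxy hy (by linarith)
      have h2 : slope F x (x + η) ≤ 1 / η := by
        rw [slope_def_field, add_sub_cancel_left]
        gcongr
        exact hinc _ _ (by linarith)
      calc _ ≤ C * slope F x (x + η) := h1
        _ ≤ C * (1 / η) := by gcongr
        _ = C / η := by ring
        _ ≤ _ := by gcongr; linarith
    · rw [slope_def_field]
      calc _ ≤ 1 / η := by
            gcongr
            · exact hinc _ _ hyx
            · linarith
        _ ≤ _ := by gcongr; linarith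
  -- Intervals shorter than `δ` are covered by `C`. The longer ones have slope at least `μ`, against
  -- the uniform upper bound `(C + 1) / η` for all slopes.
  refine ⟨max C ((C + 1) / η / μ), lt_max_of_lt_left hC, ?_⟩
  intro u x y v hux hxy hyv hvu
  have huv : u < v := by linarith
  have hs := slope_pos_of_strictMono hF huv
  rcases lt_or_ge v (u + δ) with hv | hv
  · refine ((h u (mem_univ _)).1 x y v hux hxy hyv hv).trans ?_
    gcongr
    exact le_max_left _ _
  · have h1 : μ ≤ slope F u v := by
      rw [slope_def_field, le_div_iff₀ (by linarith)]
      have := hμF u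
      have := F.monotone (by linarith : u + η ≤ v)
      nlinarith
    calc _ ≤ (C + 1) / η := hup x y hxy (by linarith)
      _ = (C + 1) / η / μ * μ := by field_simp
      _ ≤ _ := by
        gcongr
        exact le_max_right _ _

/-- The distortion of cross-ratios under `F` is bounded on intervals of length at most one, and
it is controlled by the length on short intervals which avoid the translates of `S`. -/
def CrossRatioBounds (F : ℝ → ℝ) (C K δ : ℝ) (S : Finset ℝ) : Prop :=
  ∀ a b c e : ℝ, a < b → b < c → c < e → e ≤ a + 1 →
    crossRatio (F a) (F b) (F c) (F e) ≤ C * crossRatio a b c e ∧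
    (e < a + δ → (∀ y ∈ S, ∀ p : ℤ, y + p ∉ Icc a e) →
      crossRatio (F a) (F b) (F c) (F e) ≤ Real.exp (K * (e - a)) * crossRatio a b c e)

theorem exists_crossRatioBounds {F : CircleDeg1Lift} (hF : StrictMono F) (hC : ContDiff ℝ 3 F)
    (hfin : (criticalSet F).Finite)
    (hcr : ∀ c : ℝ, deriv F c = 0 → ∃ d : ℝ, IsNonFlatCriticalPoint F c d) :
    ∃ (C K δ : ℝ) (S : Finset ℝ), 1 ≤ C ∧ 0 ≤ K ∧ 0 < δ ∧ CrossRatioBounds F C K δ S := by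
  obtain ⟨C, K, δ, hC0, hK, hδ, h⟩ := exists_distortionOn_Icc hF hC hcr
  have h := h.to_univ
  obtain ⟨D, hD, hDs⟩ := h.exists_slope_le hF hC.continuous hC0 hδ
  -- `S` consists of one real representative of each critical point on the circle; `D` enters once
  -- for each of the two slopes.
  refine ⟨max 1 (D * D), K, δ, hfin.toFinset.image Quotient.out, le_max_left _ _, hK, hδ, ?_⟩
  intro a b c e hab hbc hce hea
  constructor
  · apply crossRatio_comp_le hF hab hbc hce
    have h1 := hDs a a b c le_rfl hab hbc.le (by linarith)
    have h2 := hDs b c e e hbc.le hce le_rfl (by linarith)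
    have p1 := slope_pos_of_strictMono hF hab
    have p2 := slope_pos_of_strictMono hF hce
    have p3 := slope_pos_of_strictMono hF (hab.trans hbc)
    have p4 := slope_pos_of_strictMono hF (hbc.trans hce)
    calc _ ≤ (D * slope F a c) * (D * slope F b e) := by gcongr
      _ = D * D * (slope F a c * slope F b e) := by ring
      _ ≤ _ := by gcongr; exact le_max_right _ _
  · intro hea' hS
    apply crossRatio_comp_le hF hab hbc hce
    refine (h a (mem_univ _)).2 b c e hab hbc hce hea' ?_
    intro x hx hx0
    have hmem : (x : UnitAddCircle) ∈ criticalSet F := ⟨x, rfl, hx0⟩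
    have hout : ((Quotient.out (x : UnitAddCircle) : ℝ) : UnitAddCircle) = x :=
      Quotient.out_eq (x : UnitAddCircle)
    have h0 : ((x - Quotient.out (x : UnitAddCircle) : ℝ) : UnitAddCircle) = 0 := by
      rw [AddCircle.coe_sub, hout, sub_self]
    obtain ⟨n, hn⟩ := (AddCircle.coe_eq_zero_iff (1 : ℝ)).1 h0
    refine hS (Quotient.out (x : UnitAddCircle)) ?_ n ?_
    · exact Finset.mem_image_of_mem _ (hfin.mem_toFinset.2 hmem)
    · have : Quotient.out (x : UnitAddCircle) + (n : ℝ) = x := by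
        rw [zsmul_eq_mul, mul_one] at hn
        rw [hn]; ring
      rwa [this]

/-! ### The cross-ratio inequality for iterates -/

/-- The integrand counts the integer translates of `y` in `(a, e]`, so the total length of a family
of intervals is the integral of its multiplicity. -/
theorem integral_floor_sub_floor (a e : ℝ) :
    ∫ y in (0 : ℝ)..1, ((⌊e - y⌋ : ℝ) - ⌊a - y⌋) = e - a := by
  have hfl (t : ℝ) : IntervalIntegrable (fun y : ℝ => (⌊t - y⌋ : ℝ)) MeasureTheory.volume 0 1 := by
    apply Antitone.intervalIntegrable
    intro x y hxy
    change (⌊t - y⌋ : ℝ) ≤ ⌊t - x⌋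
    exact_mod_cast Int.floor_mono (by linarith : t - y ≤ t - x)
  have hfract : ∀ t : ℝ, ∫ y in (0 : ℝ)..1, (t - y - (⌊t - y⌋ : ℝ)) =
      ∫ y in (0 : ℝ)..1, Int.fract y := by
    intro t
    have h1 : ∫ y in (0 : ℝ)..1, (t - y - (⌊t - y⌋ : ℝ)) = ∫ y in (0 : ℝ)..1, Int.fract (t - y) :=
      rfl
    rw [h1, intervalIntegral.integral_comp_sub_left (fun y => Int.fract y) t]
    have hper : Function.Periodic (fun y : ℝ => Int.fract y) 1 := fun y => Int.fract_add_one y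
    have := hper.intervalIntegral_add_eq (t - 1) 0
    simpa using this
  have hlin (t : ℝ) : IntervalIntegrable (fun y : ℝ => t - y) MeasureTheory.volume 0 1 :=
    (continuous_const.sub continuous_id).intervalIntegrable _ _
  have h1 := hfract e
  have h2 := hfract a
  rw [intervalIntegral.integral_sub (hlin _) (hfl _)] at h1 h2
  rw [intervalIntegral.integral_sub (hfl _) (hfl _)]
  have h3 : (∫ y in (0 : ℝ)..1, (e - y)) - ∫ y in (0 : ℝ)..1, (a - y) = e - a := by
    rw [← intervalIntegral.integral_sub (hlin _) (hlin _)]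
    simp
  linarith

open Classical in
/-- If intervals of length less than one cover every point of the circle at most `m` times, then the
sum of their lengths is at most `m`. -/
theorem sum_length_le_of_multiplicity {ι : Type*} (s : Finset ι) (a e : ι → ℝ) {m : ℝ}
    (hae : ∀ i ∈ s, e i < a i + 1)
    (hm : ∀ y : ℝ, ((s.filter fun i => ∃ p : ℤ, y + p ∈ Icc (a i) (e i)).card : ℝ) ≤ m) :
    ∑ i ∈ s, (e i - a i) ≤ m := by
  have hfl (t : ℝ) : IntervalIntegrable (fun y : ℝ => (⌊t - y⌋ : ℝ)) MeasureTheory.volume 0 1 := by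
    apply Antitone.intervalIntegrable
    intro x y hxy
    change (⌊t - y⌋ : ℝ) ≤ ⌊t - x⌋
    exact_mod_cast Int.floor_mono (by linarith : t - y ≤ t - x)
  have h1 : ∑ i ∈ s, (e i - a i) =
      ∫ y in (0 : ℝ)..1, ∑ i ∈ s, ((⌊e i - y⌋ : ℝ) - ⌊a i - y⌋) := by
    rw [intervalIntegral.integral_finsetSum fun i _ => (hfl _).sub (hfl _)]
    simp only [integral_floor_sub_floor]
  have h2 : ∫ y in (0 : ℝ)..1, ∑ i ∈ s, ((⌊e i - y⌋ : ℝ) - ⌊a i - y⌋) ≤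
      ∫ _ in (0 : ℝ)..1, m := by
    refine intervalIntegral.integral_mono_on zero_le_one ?_ (by simp) ?_
    · have : IntervalIntegrable (∑ i ∈ s, fun y : ℝ => ((⌊e i - y⌋ : ℝ) - ⌊a i - y⌋))
          MeasureTheory.volume 0 1 := IntervalIntegrable.sum s fun i _ => (hfl _).sub (hfl _)
      convert this using 1
      ext y
      simp
    · intro y _
      refine le_trans ?_ (hm y)
      rw [Finset.card_filter]
      push_cast
      refine Finset.sum_le_sum fun i hi => ?_
      have hlt : ⌊e i - y⌋ ≤ ⌊a i - y⌋ + 1 := by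
        rw [← Int.floor_add_one]
        exact Int.floor_mono (by linarith [hae i hi])
      split_ifs with h
      · have : (⌊e i - y⌋ : ℝ) ≤ ⌊a i - y⌋ + 1 := by exact_mod_cast hlt
        linarith
      · have : ⌊e i - y⌋ ≤ ⌊a i - y⌋ := by
          by_contra! hcon
          -- The largest integer translate of `y` not exceeding `e i` lies beyond `a i`, as the two
          -- floors differ.
          refine h ⟨⌊e i - y⌋, ?_, ?_⟩
          · have h3 : a i - y < ⌊a i - y⌋ + 1 := Int.lt_floor_add_one _
            have h4 : ((⌊a i - y⌋ : ℝ)) + 1 ≤ ⌊e i - y⌋ := by exact_mod_cast hcon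
            linarith
          · linarith [Int.floor_le (e i - y)]
        have : (⌊e i - y⌋ : ℝ) ≤ ⌊a i - y⌋ := by exact_mod_cast this
        linarith
  rw [h1]
  simpa using h2

theorem semiconj_iterate {F h : CircleDeg1Lift} {α : ℝ} (hsemi : ∀ x, h (F x) = h x + α) (i : ℕ)
    (x : ℝ) : h (F^[i] x) = h x + i * α := by
  induction i with
  | zero => simp
  | succ i ih =>
    rw [Function.iterate_succ_apply', hsemi, ih]
    push_cast
    ring

open Classical in
/-- The first `N` iterates of an interval of length at most `L / N`, measured by the semiconjugacy
to a badly approximable rotation, cover every point a bounded number of times. -/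
theorem multiplicity_le {F h : CircleDeg1Lift} {α c₀ L : ℝ} (hsemi : ∀ x, h (F x) = h x + α)
    (hc₀ : 0 < c₀) (hbad : BadlyApproximableWith c₀ α) {N k : ℕ} (hN : 1 ≤ N) (hk : k ≤ N)
    {a e : ℝ} (hae : a ≤ e) (hL : h e - h a ≤ L / N) (y : ℝ) :
    (((Finset.range k).filter fun i => ∃ p : ℤ, y + p ∈ Icc (F^[i] a) (F^[i] e)).card : ℝ) ≤
      L / c₀ + 1 := by
  have hNR : (0 : ℝ) < N := by exact_mod_cast hN
  choose! p hp using fun (i : ℕ) (hi : ∃ p : ℤ, y + p ∈ Icc (F^[i] a) (F^[i] e)) => hi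
  -- If `y + p i` lies in the `i`-th iterate, then `i * α - p i` lies between `h y - h e` and `h y -
  -- h a`, an interval of length at most `L / N`; these points are `c₀ / N`-separated.
  have key := card_le_of_separated
    ((Finset.range k).filter fun i => ∃ p : ℤ, y + p ∈ Icc (F^[i] a) (F^[i] e))
    (fun i => i * α - p i) (η := c₀ / N) (u := h y - h e) (l := h e - h a) (by positivity)
    (by linarith [h.monotone hae]) ?_ ?_
  · refine key.trans ?_
    have : L / c₀ = L / N / (c₀ / N) := by field_simp
    rw [this]
    gcongr
  · intro i hi
    have hi' := hp i (Finset.mem_filter.1 hi).2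
    have h1 := h.monotone hi'.1
    have h2 := h.monotone hi'.2
    rw [semiconj_iterate hsemi, h.map_add_int] at h1 h2
    constructor <;> linarith
  · intro i hi j hj hij
    have hi' := Finset.mem_range.1 (Finset.mem_filter.1 hi).1
    have hj' := Finset.mem_range.1 (Finset.mem_filter.1 hj).1
    exact hbad.separated hc₀ (by omega) (by omega) hij _ _

-- The bounds for single steps are multiplied along the orbit. Only long intervals and those meeting
-- a critical point pay the factor `C`; the exponential, being at least one, may be charged to all.
open Classical in
theorem crossRatio_iterate_le_prod {F : CircleDeg1Lift} {C K δ : ℝ} {S : Finset ℝ}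
    (hF : StrictMono F) (hC : 1 ≤ C) (hK : 0 ≤ K) (hB : CrossRatioBounds F C K δ S)
    {a b c e : ℝ} (hab : a < b) (hbc : b < c) (hce : c < e) (hea : e < a + 1) (k : ℕ) :
    crossRatio (F^[k] a) (F^[k] b) (F^[k] c) (F^[k] e) ≤
      (∏ i ∈ Finset.range k, ((if δ ≤ F^[i] e - F^[i] a ∨
          ∃ y ∈ S, ∃ p : ℤ, y + p ∈ Icc (F^[i] a) (F^[i] e) then C else 1) *
        Real.exp (K * (F^[i] e - F^[i] a)))) * crossRatio a b c e := by
  induction k with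
  | zero => simp
  | succ k ih =>
    have hFk : StrictMono F^[k] := hF.iterate k
    have hek : F^[k] e ≤ F^[k] a + 1 := by
      have h1 := hFk hea
      rw [← CircleDeg1Lift.coe_pow, CircleDeg1Lift.map_add_one, CircleDeg1Lift.coe_pow] at h1
      exact h1.le
    obtain ⟨h1, h2⟩ := hB _ _ _ _ (hFk hab) (hFk hbc) (hFk hce) hek
    have hpos := (crossRatio_pos (hFk hab) (hFk hbc) (hFk hce)).le
    have hlen : 0 ≤ F^[k] e - F^[k] a := by
      linarith [hFk (hab.trans (hbc.trans hce))]
    rw [Finset.prod_range_succ]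
    simp only [Function.iterate_succ_apply']
    have step : crossRatio (F (F^[k] a)) (F (F^[k] b)) (F (F^[k] c)) (F (F^[k] e)) ≤
        ((if δ ≤ F^[k] e - F^[k] a ∨ ∃ y ∈ S, ∃ p : ℤ, y + p ∈ Icc (F^[k] a) (F^[k] e)
          then C else 1) * Real.exp (K * (F^[k] e - F^[k] a))) *
        crossRatio (F^[k] a) (F^[k] b) (F^[k] c) (F^[k] e) := by
      split_ifs with hbadk
      · have : 1 ≤ Real.exp (K * (F^[k] e - F^[k] a)) := Real.one_le_exp (by positivity)
        refine h1.trans ?_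
        gcongr
        nlinarith
      · rw [one_mul]
        push Not at hbadk
        exact h2 (by linarith [hbadk.1]) (fun y hy p => hbadk.2 y hy p)
    refine step.trans ?_
    have hfac : 0 ≤ ((if δ ≤ F^[k] e - F^[k] a ∨ ∃ y ∈ S, ∃ p : ℤ, y + p ∈ Icc (F^[k] a) (F^[k] e)
          then C else 1) * Real.exp (K * (F^[k] e - F^[k] a))) := by
      split_ifs <;> positivity
    refine (mul_le_mul_of_nonneg_left ih hfac).trans (le_of_eq ?_)
    ring

theorem exists_crossRatio_iterate_le {F h : CircleDeg1Lift} {α c₀ C K δ : ℝ} {S : Finset ℝ}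
    (hF : StrictMono F) (hsemi : ∀ x, h (F x) = h x + α) (hc₀ : 0 < c₀)
    (hbad : BadlyApproximableWith c₀ α) (hC : 1 ≤ C) (hK : 0 ≤ K) (hδ : 0 < δ)
    (hB : CrossRatioBounds F C K δ S) (L : ℝ) :
    ∃ B : ℝ, 1 ≤ B ∧ ∀ N : ℕ, 1 ≤ N → ∀ a b c e : ℝ, a < b → b < c → c < e →
      h e - h a ≤ L / N → h e - h a < 1 → ∀ k ≤ N,
      crossRatio (F^[k] a) (F^[k] b) (F^[k] c) (F^[k] e) ≤ B * crossRatio a b c e := by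
  classical
  obtain ⟨m, hm⟩ : ∃ m : ℝ, m = max (L / c₀ + 1) 0 := ⟨_, rfl⟩
  have hm0 : 0 ≤ m := hm ▸ le_max_right _ _
  -- `M` bounds the number of costly iterates: at most `m / δ` are long, as the lengths sum to at
  -- most `m`, and at most `m` contain a translate of any given point of `S`.
  obtain ⟨M, hM⟩ : ∃ M : ℕ, m / δ + S.card * m ≤ M := exists_nat_ge _
  refine ⟨C ^ M * Real.exp (K * m), ?_, ?_⟩
  · exact one_le_mul_of_one_le_of_one_le (one_le_pow₀ hC) (Real.one_le_exp (by positivity))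
  intro N hN a b c e hab hbc hce hL h1 k hk
  have hae : a < e := hab.trans (hbc.trans hce)
  have hea : e < a + 1 := by
    by_contra! hcon
    have := h.monotone hcon
    rw [h.map_add_one] at this
    linarith
  have hmult : ∀ y : ℝ, (((Finset.range k).filter
      fun i => ∃ p : ℤ, y + p ∈ Icc (F^[i] a) (F^[i] e)).card : ℝ) ≤ m := fun y =>
    (multiplicity_le hsemi hc₀ hbad hN hk hae.le hL y).trans (hm ▸ le_max_left _ _)
  have hsum : ∑ i ∈ Finset.range k, (F^[i] e - F^[i] a) ≤ m := by
    refine sum_length_le_of_multiplicity _ _ _ ?_ hmult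
    intro i _
    have h1 := hF.iterate i hea
    rwa [← CircleDeg1Lift.coe_pow, CircleDeg1Lift.map_add_one, CircleDeg1Lift.coe_pow] at h1
  refine (crossRatio_iterate_le_prod hF hC hK hB hab hbc hce hea k).trans ?_
  refine mul_le_mul_of_nonneg_right ?_ (crossRatio_pos hab hbc hce).le
  rw [Finset.prod_mul_distrib, ← Real.exp_sum, ← Finset.mul_sum, Finset.prod_ite, Finset.prod_const,
    Finset.prod_const_one, mul_one]
  have hlen : ∀ i, 0 ≤ F^[i] e - F^[i] a := fun i => by linarith [hF.iterate i hae]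
  have hcard : ((Finset.range k).filter fun i => δ ≤ F^[i] e - F^[i] a ∨
      ∃ y ∈ S, ∃ p : ℤ, y + p ∈ Icc (F^[i] a) (F^[i] e)).card ≤ M := by
    have c1 : (((Finset.range k).filter fun i => δ ≤ F^[i] e - F^[i] a).card : ℝ) ≤ m / δ := by
      rw [le_div_iff₀ hδ, ← nsmul_eq_mul]
      refine le_trans ?_ hsum
      refine (Finset.card_nsmul_le_sum _ (fun i => F^[i] e - F^[i] a) δ
        fun i hi => (Finset.mem_filter.1 hi).2).trans ?_
      exact Finset.sum_le_sum_of_subset_of_nonneg (Finset.filter_subset _ _) fun i _ _ => hlen i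
    have c2 : ((Finset.range k).filter fun i => δ ≤ F^[i] e - F^[i] a ∨
        ∃ y ∈ S, ∃ p : ℤ, y + p ∈ Icc (F^[i] a) (F^[i] e)).card ≤
        ((Finset.range k).filter fun i => δ ≤ F^[i] e - F^[i] a).card +
        ∑ y ∈ S, ((Finset.range k).filter
          fun i => ∃ p : ℤ, y + p ∈ Icc (F^[i] a) (F^[i] e)).card := by
      refine le_trans (Finset.card_le_card ?_) ((Finset.card_union_le _
        (S.biUnion fun y => (Finset.range k).filter
          fun i => ∃ p : ℤ, y + p ∈ Icc (F^[i] a) (F^[i] e))).trans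
        (add_le_add_right Finset.card_biUnion_le _))
      intro i hi
      simp only [Finset.mem_filter, Finset.mem_union, Finset.mem_biUnion] at hi ⊢
      obtain ⟨h1, h2 | ⟨y, hy, h2⟩⟩ := hi
      · exact Or.inl ⟨h1, h2⟩
      · exact Or.inr ⟨y, hy, h1, h2⟩
    have c3 : ((∑ y ∈ S, ((Finset.range k).filter
          fun i => ∃ p : ℤ, y + p ∈ Icc (F^[i] a) (F^[i] e)).card : ℕ) : ℝ) ≤ S.card * m := by
      push_cast
      rw [← nsmul_eq_mul]
      exact Finset.sum_le_card_nsmul _ _ _ fun y _ => hmult y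
    have c4 : ((((Finset.range k).filter fun i => δ ≤ F^[i] e - F^[i] a ∨
        ∃ y ∈ S, ∃ p : ℤ, y + p ∈ Icc (F^[i] a) (F^[i] e)).card : ℕ) : ℝ) ≤ M := by
      refine (Nat.cast_le.2 c2).trans ?_
      push_cast at c3 ⊢
      linarith
    exact_mod_cast c4
  gcongr

/-! ### Adjacent displacements are comparable -/

theorem crossRatio_sub (a b c e p : ℝ) :
    crossRatio (a - p) (b - p) (c - p) (e - p) = crossRatio a b c e := by
  simp only [crossRatio, sub_sub_sub_cancel_right]

theorem crossRatio_eq_mul (a b c e : ℝ) :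
    crossRatio a b c e = (b - a) / (c - a) * ((e - c) / (e - b)) := by
  rw [crossRatio, div_mul_div_comm]

/-- The cross-ratio is a product of two factors at most one, so each factor is at least `κ`. -/
theorem mul_le_of_le_crossRatio {a b c e κ : ℝ} (hab : a < b) (hbc : b < c) (hce : c < e)
    (h : κ ≤ crossRatio a b c e) : κ * (c - a) ≤ b - a ∧ κ * (e - b) ≤ e - c := by
  rw [crossRatio_eq_mul] at h
  have h1 : (b - a) / (c - a) ≤ 1 := (div_le_one (by linarith)).2 (by linarith)
  have h2 : (e - c) / (e - b) ≤ 1 := (div_le_one (by linarith)).2 (by linarith)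
  have h3 : 0 ≤ (b - a) / (c - a) := div_nonneg (by linarith) (by linarith)
  have h4 : 0 ≤ (e - c) / (e - b) := div_nonneg (by linarith) (by linarith)
  rw [← le_div_iff₀ (by linarith), ← le_div_iff₀ (by linarith)]
  constructor <;> nlinarith

theorem le_crossRatio {a b c e δ M : ℝ} (hM : 0 ≤ M) (hab : a < b) (hbc : b < c) (hce : c < e)
    (h1 : δ ≤ b - a) (h2 : δ ≤ e - c) (h3 : c - b ≤ M * δ) :
    (1 / (1 + M)) ^ 2 ≤ crossRatio a b c e := by
  have e1 : 1 / (1 + M) ≤ (b - a) / (c - a) := by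
    rw [div_le_div_iff₀ (by linarith) (by linarith)]; nlinarith
  have e2 : 1 / (1 + M) ≤ (e - c) / (e - b) := by
    rw [div_le_div_iff₀ (by linarith) (by linarith)]; nlinarith
  rw [crossRatio_eq_mul, sq]
  exact mul_le_mul e1 e2 (by positivity) (div_nonneg (by linarith) (by linarith))

/-- The displacement of a continuous lift of degree one attains its minimum. -/
theorem exists_min_displacement {G : CircleDeg1Lift} (hG : Continuous G) :
    ∃ z : ℝ, ∀ x : ℝ, G z - z ≤ G x - x := by
  obtain ⟨z, -, hz⟩ := isCompact_Icc.exists_isMinOn (s := Icc (0 : ℝ) 1)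
    (nonempty_Icc.2 zero_le_one) (f := fun u => G u - u) (by fun_prop)
  refine ⟨z, fun x => ?_⟩
  have h1 := hz ⟨Int.fract_nonneg x, (Int.fract_lt_one x).le⟩
  simp only [mem_ofPred_eq, CircleDeg1Lift.map_fract_sub_fract_eq] at h1
  exact h1

/-- `G` is a lift which `h` semiconjugates to the
translation by `s`, and whose displacements at `x` and at `G x` are comparable. -/
structure ComparableDisplacement (h : ℝ → ℝ) (D s : ℝ) (G : CircleDeg1Lift) : Prop where
  strictMono : StrictMono G
  surjective : Function.Surjective G
  semiconj : ∀ x, h (G x) = h x + s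
  lt_map : ∀ x, x < G x
  le_mul : ∀ x, G (G x) - G x ≤ D * (G x - x)
  le_mul' : ∀ x, G x - x ≤ D * (G (G x) - G x)

/-- Let `z` minimize the displacement. Around `z` the cross-ratio inequality bounds neighbouring
displacements by the minimum; an iterate of any `x` lands there, and the bound is pulled back to
`x`. -/
theorem comparableDisplacement_of_crossRatio_le {F h G : CircleDeg1Lift} {B s : ℝ} {N q : ℕ} {p : ℤ}
    (hB : 1 ≤ B) (hG : StrictMono G) (hGc : Continuous G) (hGF : ∀ x, G x = F^[q] x - p)
    (hq : q ≤ N) (hlt : ∀ x, x < G x) (hGs : ∀ x, h (G x) = h x + s)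
    (hcr : ∀ x, ∀ k ≤ N, crossRatio (F^[k] x) (F^[k] (G x)) (F^[k] (G (G x))) (F^[k] (G (G (G x)))) ≤
      B * crossRatio x (G x) (G (G x)) (G (G (G x))))
    (hhit : ∀ x u : ℝ, ∃ k ≤ N, ∃ m : ℤ, u < h (F^[k] x - m) ∧ h (F^[k] x - m) < u + s) :
    ComparableDisplacement h ((1 + 5 * B) ^ 2 * B) s G := by
  have hsurj : Function.Surjective G := G.continuous_iff_surjective.1 hGc
  have hFG (k : ℕ) (x : ℝ) : F^[k] (G x) = G (F^[k] x) := by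
    rw [hGF, hGF, ← CircleDeg1Lift.coe_pow F k, CircleDeg1Lift.map_sub_int, CircleDeg1Lift.coe_pow,
      ← Function.iterate_add_apply, ← Function.iterate_add_apply, add_comm]
  have hcr' (x : ℝ) (k : ℕ) (hk : k ≤ N) (m : ℤ) :
      crossRatio (F^[k] x - m) (G (F^[k] x - m)) (G (G (F^[k] x - m))) (G (G (G (F^[k] x - m)))) ≤
      B * crossRatio x (G x) (G (G x)) (G (G (G x))) := by
    have := hcr x k hk
    simp only [CircleDeg1Lift.map_sub_int, crossRatio_sub]
    simpa only [hFG] using this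
  obtain ⟨z, hz⟩ := exists_min_displacement hGc
  have hδ : 0 < G z - z := by linarith [hlt z]
  obtain ⟨z₁, hz₁⟩ := hsurj z
  obtain ⟨z₂, hz₂⟩ := hsurj z₁
  have hz₁z : z₁ < z := hz₁ ▸ hlt z₁
  -- At `z₁` the middle interval is the shortest one, so the cross-ratio is at least `1 / 4`. As `G`
  -- is `F^[q]` up to an integer, the one at `z₂` is at least `1 / (4 * B)`, which bounds `z - z₁`.
  have hd₁ : z - z₁ ≤ 4 * B * (G z - z) := by
    have h1 := hcr' z₂ q hq p
    rw [← hGF, hz₂, hz₁] at h1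
    have h2 : (1 / (1 + 1) : ℝ) ^ 2 ≤ crossRatio z₁ z (G z) (G (G z)) := by
      refine le_crossRatio (δ := G z - z) zero_le_one hz₁z (hlt _) (hlt _) ?_ (hz _) (by linarith)
      have := hz z₁
      rwa [hz₁] at this
    have h3 : 1 / (4 * B) ≤ crossRatio z₂ z₁ z (G z) := by
      rw [div_le_iff₀ (by linarith)]
      norm_num at h2
      linarith
    have h4 := (mul_le_of_le_crossRatio (hz₂ ▸ hlt z₂) hz₁z (hlt z) h3).2
    rw [div_mul_eq_mul_div, one_mul, div_le_iff₀ (by linarith)] at h4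
    linarith
  have hκ (x : ℝ) : 1 / ((1 + 5 * B) ^ 2 * B) ≤ crossRatio x (G x) (G (G x)) (G (G (G x))) := by
    obtain ⟨k, hk, m, hm1, hm2⟩ := hhit (G x) (h z₁)
    have hz' : h z = h z₁ + s := by rw [← hGs, hz₁]
    rw [← hz'] at hm2
    have e1 : F^[k] (G x) - m = G (F^[k] x - m) := by rw [hFG, CircleDeg1Lift.map_sub_int]
    rw [e1] at hm1 hm2
    have hw1 : z₁ < G (F^[k] x - m) := by
      by_contra! hcon
      exact absurd hm1 (not_lt.2 (h.monotone hcon))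
    have hw2 : G (F^[k] x - m) < z := by
      by_contra! hcon
      exact absurd hm2 (not_lt.2 (h.monotone hcon))
    have h1 := hcr' x k hk m
    -- Since `G w` lies in `(z₁, z)`, the middle interval `[G w, G (G w)]` is inside `[z₁, G z]`, of
    -- length at most `5 * B` times the minimal displacement; the outer intervals are at least that
    -- minimum.
    set w := F^[k] x - m
    have h2 : (1 / (1 + 5 * B)) ^ 2 ≤ crossRatio w (G w) (G (G w)) (G (G (G w))) := by
      refine le_crossRatio (δ := G z - z) (by linarith) (hlt _) (hlt _) (hlt _) (hz _) (hz _) ?_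
      have := hG hw2
      nlinarith
    have h3 := h2.trans h1
    rw [div_le_iff₀ (by positivity)]
    rw [div_pow, one_pow, div_le_iff₀ (by positivity)] at h3
    linarith
  have hDpos : 0 < (1 + 5 * B) ^ 2 * B := by positivity
  refine ⟨hG, hsurj, hGs, hlt, fun x => ?_, fun x => ?_⟩
  · have h1 := (mul_le_of_le_crossRatio (hlt _) (hlt _) (hlt _) (hκ x)).1
    rw [div_mul_eq_mul_div, one_mul, div_le_iff₀ hDpos] at h1
    linarith [hlt x]
  · obtain ⟨y, rfl⟩ := hsurj x
    have h1 := (mul_le_of_le_crossRatio (hlt _) (hlt _) (hlt _) (hκ y)).2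
    rw [div_mul_eq_mul_div, one_mul, div_le_iff₀ hDpos] at h1
    linarith [hlt (G (G y))]

theorem exists_comparableDisplacement {F h : CircleDeg1Lift} {α c₀ C K δ : ℝ} {S : Finset ℝ}
    (hF : StrictMono F) (hFc : Continuous F) (hsemi : ∀ x, h (F x) = h x + α) (hc₀ : 0 < c₀)
    (hbad : BadlyApproximableWith c₀ α) (hC : 1 ≤ C) (hK : 0 ≤ K) (hδ : 0 < δ)
    (hB : CrossRatioBounds F C K δ S) :
    ∃ (D A : ℝ) (N₀ : ℕ), 0 < D ∧ 0 < A ∧ 1 ≤ N₀ ∧ ∀ N ≥ N₀, ∃ (G : CircleDeg1Lift) (s : ℝ),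
      A / N ≤ s ∧ s ≤ 2 * A / N ∧ s ≤ 1 ∧ ComparableDisplacement h D s G := by
  obtain ⟨A, hA⟩ : ∃ A : ℝ, A = 2 + 1 / c₀ := ⟨_, rfl⟩
  have hA0 : 0 < A := by rw [hA]; positivity
  -- Three steps of `G` advance `h` by `3 * s ≤ 6 * A / N`.
  obtain ⟨B, hB1, hBcr⟩ := exists_crossRatio_iterate_le hF hsemi hc₀ hbad hC hK hδ hB (6 * A)
  obtain ⟨N₀, hN₀⟩ := exists_nat_gt (6 * A)
  have hN₀1 : 1 ≤ N₀ := by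
    have : (0 : ℝ) < N₀ := by linarith
    exact_mod_cast this
  refine ⟨(1 + 5 * B) ^ 2 * B, A, N₀, by positivity, hA0, hN₀1, fun N hN => ?_⟩
  have hN1 : 1 ≤ N := hN₀1.trans hN
  have hNR : (0 : ℝ) < N := by exact_mod_cast hN1
  have hNR' : (N₀ : ℝ) ≤ N := by exact_mod_cast hN
  have hsmall : 6 * A / N < 1 := by rw [div_lt_one hNR]; linarith
  obtain ⟨q, p, hq1, hqN, h1, h2⟩ := hbad.exists_dense hc₀ N hN1 (A / N)
  rw [← hA] at h2
  obtain ⟨s, hs⟩ : ∃ s : ℝ, s = q * α - p := ⟨_, rfl⟩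
  rw [← hs] at h1 h2
  have hs0 : 0 < s := lt_trans (by positivity) h1
  have e2 : A / N + A / N = 2 * A / N := by ring
  have e6 : 6 * A / N = 3 * (2 * A / N) := by ring
  have hs2 : s ≤ 2 * A / N := by linarith
  obtain ⟨G, hGF⟩ : ∃ G : CircleDeg1Lift, ∀ x, G x = F^[q] x - p := by
    refine ⟨⟨⟨fun x => F^[q] x - p, fun x y hxy => ?_⟩, fun x => ?_⟩, fun x => rfl⟩
    · exact sub_le_sub_right (F.monotone.iterate q hxy) _
    · change F^[q] (x + 1) - p = F^[q] x - p + 1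
      rw [← CircleDeg1Lift.coe_pow, CircleDeg1Lift.map_add_one]
      ring
  have hGs (x : ℝ) : h (G x) = h x + s := by
    rw [hGF, h.map_sub_int, semiconj_iterate hsemi, hs]
    ring
  have hlt (x : ℝ) : x < G x := by
    by_contra! hcon
    have := h.monotone hcon
    rw [hGs] at this
    linarith
  refine ⟨G, s, h1.le, hs2, by linarith, ?_⟩
  refine comparableDisplacement_of_crossRatio_le (F := F) (N := N) (q := q) (p := p) hB1 ?_ ?_ hGF
    hqN hlt hGs ?_ ?_
  · intro x y hxy
    rw [hGF, hGF]
    exact sub_lt_sub_right (hF.iterate q hxy) _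
  · have : (G : ℝ → ℝ) = fun x => F^[q] x - p := funext hGF
    rw [this]
    exact (hFc.iterate q).sub continuous_const
  · intro x k hk
    refine hBcr N hN1 _ _ _ _ (hlt _) (hlt _) (hlt _) ?_ ?_ k hk
    · simp only [hGs]
      linarith
    · simp only [hGs]
      linarith
  · intro x u
    obtain ⟨k, m, -, hkN, hk1, hk2⟩ := hbad.exists_dense hc₀ N hN1 (u - h x)
    rw [← hA] at hk2
    refine ⟨k, hkN, m, ?_, ?_⟩ <;> rw [h.map_sub_int, semiconj_iterate hsemi] <;> linarith

/-! ### Quasisymmetric maps of the line -/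

/-- The increments of `H` over adjacent intervals of length `s`, the right one against the left
one, have ratio at most `D`. -/
def IncrementLE (H : ℝ → ℝ) (D s : ℝ) : Prop :=
  ∀ v, H (v + s) - H v ≤ D * (H v - H (v - s))

/-- Both ratios of the increments of `H` over adjacent intervals of equal lengths are at most `D`. -/
def IsQuasisymmetricWith (H : ℝ → ℝ) (D : ℝ) : Prop :=
  ∀ s, 0 < s → IncrementLE H D s ∧ IncrementLE (fun x => -H (-x)) D s

theorem incrementLE_reflect {H : ℝ → ℝ} {D s : ℝ} :
    IncrementLE (fun x => -H (-x)) D s ↔ ∀ v, H v - H (v - s) ≤ D * (H (v + s) - H v) := by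
  constructor
  · intro h v
    have := h (-v)
    simp only [neg_add_rev, neg_neg, neg_sub] at this
    rw [show -s + v = v - s by ring, show s - -v = v + s by ring] at this
    linarith
  · intro h v
    have := h (-v)
    simp only [neg_add_rev, neg_sub]
    rw [show -s + -v = -v - s by ring, show s - v = -v + s by ring]
    linarith

theorem monotone_reflect {H : ℝ → ℝ} (h : Monotone H) : Monotone fun x => -H (-x) :=
  fun _ _ hxy => neg_le_neg (h (neg_le_neg hxy))

/-- Successive increments grow at most by the factor `D`, so each of the `n` increments is at most
`D ^ n` times the initial one. -/
theorem IncrementLE.mul_nat {H : ℝ → ℝ} {D s : ℝ} (hD : 1 ≤ D) (h : IncrementLE H D s)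
    (hH : Monotone H) (hs : 0 ≤ s) (n : ℕ) (v : ℝ) :
    H (v + n * s) - H v ≤ n * D ^ n * (H v - H (v - s)) := by
  have h0 : 0 ≤ H v - H (v - s) := by linarith [hH (by linarith : v - s ≤ v)]
  have key : ∀ n : ℕ, H (v + n * s) - H v ≤ n * D ^ n * (H v - H (v - s)) ∧
      H (v + n * s) - H (v + n * s - s) ≤ D ^ n * (H v - H (v - s)) := by
    intro n
    induction n with
    | zero => simp
    | succ n ih =>
      obtain ⟨h1, h2⟩ := ih
      have h3 := h (v + n * s)
      have e1 : v + (n + 1 : ℕ) * s = v + n * s + s := by push_cast; ring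
      have h4 : H (v + n * s + s) - H (v + n * s) ≤ D ^ (n + 1) * (H v - H (v - s)) := by
        rw [pow_succ']
        calc _ ≤ _ := h3
          _ ≤ D * (D ^ n * (H v - H (v - s))) := by gcongr
          _ = _ := by ring
      rw [e1, add_sub_cancel_right]
      refine ⟨?_, h4⟩
      have h5 : n * D ^ n * (H v - H (v - s)) ≤ n * D ^ (n + 1) * (H v - H (v - s)) := by
        gcongr
        omega
      push_cast
      linarith
  exact (key n).1

theorem IncrementLE.mono {H : ℝ → ℝ} {D D' s : ℝ} (h : IncrementLE H D s)
    (hH : Monotone H) (hs : 0 ≤ s) (hD : D ≤ D') : IncrementLE H D' s := by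
  intro v
  have h0 : 0 ≤ H v - H (v - s) := by linarith [hH (by linarith : v - s ≤ v)]
  exact (h v).trans (by gcongr)

theorem IncrementLE.comp {H φ : ℝ → ℝ} {D M s : ℝ} (hD : 1 ≤ D) (hH : Monotone H)
    (hHD : ∀ t, 0 < t → IncrementLE H D t) (hφ : StrictMono φ) (hφM : IncrementLE φ M s)
    (hs : 0 < s) {n : ℕ} (hn : M ≤ n) : IncrementLE (fun x => H (φ x)) (n * D ^ n) s := by
  intro v
  have hq : 0 < φ v - φ (v - s) := by linarith [hφ (by linarith : v - s < v)]
  have h1 := (hHD _ hq).mul_nat hD hH hq.le n (φ v)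
  have h2 : φ (v + s) ≤ φ v + n * (φ v - φ (v - s)) := by
    have := hφM v
    nlinarith
  have h3 := hH h2
  rw [sub_sub_cancel] at h1
  simp only
  linarith

/-- Doubling the step multiplies the increment of `H` by at least `1 + 1 / D`. After `j` doublings
it exceeds `t`, so `h` advances by at most `2 ^ j` times its previous increment. -/
theorem exists_incrementLE_inverse {H h : ℝ → ℝ} {D : ℝ} (hD : 1 ≤ D) (hh : StrictMono h)
    (hH : StrictMono H) (hHh : ∀ x, H (h x) = x) (hHD : IsQuasisymmetricWith H D) :
    ∃ j : ℕ, ∀ s, 0 < s → IncrementLE h (2 ^ j) s := by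
  obtain ⟨j, hj⟩ := pow_unbounded_of_one_lt D
    (by have : 0 < 1 / D := by positivity
        linarith : 1 < 1 + 1 / D)
  refine ⟨j, fun t ht x => ?_⟩
  have hr : 0 < h x - h (x - t) := by linarith [hh (by linarith : x - t < x)]
  set v := h x
  obtain ⟨r, hrdef⟩ : ∃ r, r = v - h (x - t) := ⟨_, rfl⟩
  rw [← hrdef] at hr ⊢
  have hv : H v = x := hHh x
  have hvr : H (v - r) = x - t := by rw [hrdef, sub_sub_cancel, hHh]
  have key : ∀ i : ℕ, (1 + 1 / D) ^ i * (t / D) ≤ H (v + 2 ^ i * r) - H v := by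
    intro i
    induction i with
    | zero =>
      have := incrementLE_reflect.1 (hHD r hr).2 v
      rw [hvr, hv] at this
      rw [pow_zero, one_mul, pow_zero, one_mul, div_le_iff₀ (by linarith), hv]
      linarith
    | succ i ih =>
      have := incrementLE_reflect.1 (hHD (2 ^ i * r) (by positivity)).2 (v + 2 ^ i * r)
      rw [add_sub_cancel_right] at this
      have e : v + 2 ^ (i + 1) * r = v + 2 ^ i * r + 2 ^ i * r := by ring
      rw [e]
      have h1 : (H (v + 2 ^ i * r) - H v) / D ≤
          H (v + 2 ^ i * r + 2 ^ i * r) - H (v + 2 ^ i * r) := by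
        rw [div_le_iff₀ (by linarith)]; linarith
      calc (1 + 1 / D) ^ (i + 1) * (t / D) = (1 + 1 / D) * ((1 + 1 / D) ^ i * (t / D)) := by ring
        _ ≤ (1 + 1 / D) * (H (v + 2 ^ i * r) - H v) := by gcongr
        _ = (H (v + 2 ^ i * r) - H v) + (H (v + 2 ^ i * r) - H v) / D := by ring
        _ ≤ _ := by linarith
  by_contra! hcon
  have h1 : v + 2 ^ j * r < h (x + t) := by linarith
  have h2 := hH h1
  rw [hHh] at h2
  have h3 := key j
  rw [hv] at h3
  have h4 : t < (1 + 1 / D) ^ j * (t / D) := by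
    rw [mul_div_assoc', lt_div_iff₀ (by linarith), mul_comm]
    gcongr
  linarith

/-- If `H` is quasisymmetric, then so are the maps `x ↦ H' (h x + a)`, where `h` is the inverse of
`H` and `H'` is quasisymmetric. -/
theorem IsQuasisymmetricWith.comp_inverse {H H' h : ℝ → ℝ} {D D' : ℝ} (hD : 1 ≤ D) (hD' : 1 ≤ D')
    (hh : StrictMono h) (hH : StrictMono H) (hH' : StrictMono H') (hHh : ∀ x, H (h x) = x)
    (hHD : IsQuasisymmetricWith H D) (hHD' : IsQuasisymmetricWith H' D') (a : ℝ) :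
    ∃ K : ℝ, 1 ≤ K ∧ IsQuasisymmetricWith (fun x => H' (h x + a)) K := by
  have hh' : StrictMono fun x => -h (-x) := fun x y hxy => neg_lt_neg (hh (neg_lt_neg hxy))
  have hHr : StrictMono fun x => -H (-x) := fun x y hxy => neg_lt_neg (hH (neg_lt_neg hxy))
  obtain ⟨i, hi⟩ := exists_incrementLE_inverse hD hh hH hHh hHD
  -- The opposite inequality is the same statement for the maps conjugated by `x ↦ -x`.
  obtain ⟨j, hj⟩ := exists_incrementLE_inverse (H := fun x => -H (-x)) (h := fun x => -h (-x)) hD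
    hh' hHr (fun x => by simp [hHh]) (fun s hs => ⟨(hHD s hs).2, by simpa using (hHD s hs).1⟩)
  have hmono : Monotone fun x => H' (h x + a) := fun x y hxy =>
    hH'.monotone (by linarith [hh.monotone hxy])
  refine ⟨max 1 (max ((2 ^ i : ℕ) * D' ^ 2 ^ i) ((2 ^ j : ℕ) * D' ^ 2 ^ j)), le_max_left _ _,
    fun s hs => ⟨?_, ?_⟩⟩
  · refine IncrementLE.mono (D := (2 ^ i : ℕ) * D' ^ 2 ^ i) ?_ hmono hs.le
      ((le_max_left _ _).trans (le_max_right _ _))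
    exact IncrementLE.comp (M := 2 ^ i) (φ := fun x => h x + a) hD' hH'.monotone
      (fun t ht => (hHD' t ht).1) (fun x y hxy => by linarith [hh hxy])
      (fun v => by have := hi s hs v; linarith) hs (by simp)
  · refine IncrementLE.mono (D := (2 ^ j : ℕ) * D' ^ 2 ^ j) ?_ (monotone_reflect hmono) hs.le
      ((le_max_right _ _).trans (le_max_right _ _))
    have := IncrementLE.comp (H := fun x => -H' (-x)) (M := 2 ^ j) (n := 2 ^ j)
      (φ := fun x => -h (-x) - a) hD' (monotone_reflect hH'.monotone)
      (fun t ht => (hHD' t ht).2) (fun x y hxy => by linarith [hh' hxy])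
      (fun v => by have := hj s hs v; linarith) hs (by simp)
    simpa [add_comm] using this

/-! ### The conjugacy to the rotation -/

/-- If `h x = h y` with `x < y`, every `G` moves `x` beyond `y`, since it strictly increases `h`.
But comparability makes the displacements at `x` decay geometrically along a sequence of scales. -/
theorem strictMono_of_comparableDisplacement {h : CircleDeg1Lift} {D A : ℝ} {N₀ : ℕ} (hD : 0 < D)
    (hA : 0 < A) (hN₀ : 1 ≤ N₀) (hG : ∀ N ≥ N₀, ∃ (G : CircleDeg1Lift) (s : ℝ),
      A / N ≤ s ∧ s ≤ 2 * A / N ∧ s ≤ 1 ∧ ComparableDisplacement h D s G) :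
    StrictMono h := by
  have hN₀R : (0 : ℝ) < N₀ := by exact_mod_cast hN₀
  refine h.monotone.strictMono_of_injective ?_
  have key : ∀ x y : ℝ, x < y → h x ≠ h y := by
    intro x y hxy heq
    -- The ratio `5` gives `s (k + 1) ≤ (2 / 5) * s k`, so that two steps of `G (k + 1)` fit inside
    -- one step of `G k`.
    choose G s h1 h2 _ hGs using fun k : ℕ => hG (N₀ * 5 ^ k)
      (Nat.le_mul_of_pos_right _ (by positivity))
    have hs (k : ℕ) : 0 < s k := lt_of_lt_of_le (by positivity) (h1 k)
    have hs' (k : ℕ) : s (k + 1) + s (k + 1) < s k := by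
      have e1 := h2 (k + 1)
      have e2 := h1 k
      have e3 : 2 * A / ((N₀ * 5 ^ (k + 1) : ℕ) : ℝ) = 2 / 5 * (A / ((N₀ * 5 ^ k : ℕ) : ℝ)) := by
        push_cast
        field_simp
        ring
      rw [e3] at e1
      linarith [hs k]
    have hdec (k : ℕ) : G k x - x ≤ (D / (D + 1)) ^ k * (G 0 x - x) := by
      induction k with
      | zero => simp
      | succ k ih =>
        have h3 : G (k + 1) (G (k + 1) x) ≤ G k x := by
          by_contra! hcon
          have := h.monotone hcon.le
          rw [(hGs k).semiconj, (hGs (k + 1)).semiconj, (hGs (k + 1)).semiconj] at this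
          linarith [hs' k]
        have h4 := (hGs (k + 1)).le_mul' x
        have h5 : G (k + 1) x - x ≤ D / (D + 1) * (G k x - x) := by
          rw [div_mul_eq_mul_div, le_div_iff₀ (by linarith)]
          nlinarith
        calc _ ≤ _ := h5
          _ ≤ D / (D + 1) * ((D / (D + 1)) ^ k * (G 0 x - x)) := by gcongr
          _ = _ := by ring
    have hy (k : ℕ) : y - x ≤ G k x - x := by
      by_contra! hcon
      have := h.monotone (by linarith : G k x ≤ y)
      rw [(hGs k).semiconj] at this
      linarith [hs k]
    have hd0 : 0 < G 0 x - x := by linarith [(hGs 0).lt_map x]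
    obtain ⟨k, hk⟩ := exists_pow_lt_of_lt_one (div_pos (sub_pos.2 hxy) hd0)
      ((div_lt_one (by linarith)).2 (by linarith) : D / (D + 1) < 1)
    rw [lt_div_iff₀ hd0] at hk
    linarith [hy k, hdec k]
  intro x y hxy
  rcases lt_trichotomy x y with h1 | h1 | h1
  · exact absurd hxy (key x y h1)
  · exact h1
  · exact absurd hxy.symm (key y x h1)

/-- A monotone map with dense range is continuous, and the range contains the integer translates of
an orbit of the rotation. -/
theorem continuous_of_semiconj {F h : CircleDeg1Lift} {α c₀ : ℝ} (hsemi : ∀ x, h (F x) = h x + α)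
    (hc₀ : 0 < c₀) (hbad : BadlyApproximableWith c₀ α) : Continuous h := by
  refine h.monotone.continuous_of_denseRange ?_
  refine dense_of_exists_between ?_
  intro u v huv
  obtain ⟨N, hN⟩ := exists_nat_gt ((2 + 1 / c₀) / (v - u))
  have huv' := sub_pos.2 huv
  have hN0 : (0 : ℝ) < N := lt_trans (by positivity) hN
  obtain ⟨i, p, -, -, h1, h2⟩ := hbad.exists_dense hc₀ N (by exact_mod_cast hN0) (u - h 0)
  have h3 : (2 + 1 / c₀) / N < v - u := by
    rw [div_lt_iff₀ hN0]
    rw [div_lt_iff₀ huv'] at hN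
    linarith
  refine ⟨h (F^[i] 0 - p), mem_range_self _, ?_, ?_⟩ <;>
    rw [h.map_sub_int, semiconj_iterate hsemi] <;> linarith

/-- The right increment is at most `⌊t⌋ + 1`, the left one at least `⌊t⌋ ≥ 1`. -/
theorem incrementLE_of_one_le (H : CircleDeg1Lift) {t : ℝ} (ht : 1 ≤ t) : IncrementLE H 2 t := by
  intro v
  have h1 := H.monotone (by push_cast; linarith [Int.lt_floor_add_one t] : v + t ≤ v + (⌊t⌋ + 1 : ℤ))
  have h2 := H.monotone (by linarith [Int.floor_le t] : v - t ≤ v - ⌊t⌋)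
  rw [H.map_add_int] at h1
  rw [H.map_sub_int] at h2
  have h3 : (1 : ℝ) ≤ ⌊t⌋ := by exact_mod_cast Int.le_floor.2 (by exact_mod_cast ht)
  push_cast at h1
  linarith

theorem exists_isQuasisymmetricWith_inverse {h H : CircleDeg1Lift} {D A : ℝ} {N₀ : ℕ}
    (hA : 0 < A) (hN₀ : 1 ≤ N₀)
    (hHh : ∀ x, H (h x) = x) (hhH : ∀ x, h (H x) = x)
    (hG : ∀ N ≥ N₀, ∃ (G : CircleDeg1Lift) (s : ℝ),
      A / N ≤ s ∧ s ≤ 2 * A / N ∧ s ≤ 1 ∧ ComparableDisplacement h D s G) :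
    ∃ K : ℝ, 1 ≤ K ∧ IsQuasisymmetricWith H K := by
  -- `n` bounds `t / s` when `s` is taken from the scale `N = N₀ + ⌈2 * A / t⌉₊`: then `s ≤ 2 * A /
  -- N ≤ t`, whereas `t * N ≤ N₀ + 2 * A + 1` and `s ≥ A / N`.
  obtain ⟨n, hn⟩ := exists_nat_ge ((N₀ + 2 * A + 1) / A)
  obtain ⟨E, hE⟩ : ∃ E : ℝ, E = max D 1 := ⟨_, rfl⟩
  have hE1 : 1 ≤ E := hE ▸ le_max_right _ _
  have hDE : D ≤ E := hE ▸ le_max_left _ _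
  have hmr := monotone_reflect H.monotone
  have hstep : ∀ t : ℝ, 0 < t → t ≤ 1 → ∃ s : ℝ, 0 < s ∧ s ≤ t ∧ t ≤ n * s ∧
      IncrementLE H E s ∧ IncrementLE (fun x => -H (-x)) E s := by
    intro t ht ht1
    obtain ⟨N, hN⟩ : ∃ N : ℕ, N = N₀ + ⌈2 * A / t⌉₊ := ⟨_, rfl⟩
    obtain ⟨G, s, h1, h2, -, hGs⟩ := hG N (by omega)
    have hNR : (0 : ℝ) < N := by exact_mod_cast (by omega : 0 < N)
    have hs : 0 < s := lt_of_lt_of_le (by positivity) h1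
    have hNR1 : 2 * A / t ≤ N := by
      have := Nat.le_ceil (2 * A / t)
      rw [hN]; push_cast
      linarith [(Nat.cast_nonneg N₀ : (0 : ℝ) ≤ N₀)]
    have hNR2 : (N : ℝ) ≤ N₀ + (2 * A / t + 1) := by
      have := (Nat.ceil_lt_add_one (by positivity : 0 ≤ 2 * A / t)).le
      rw [hN]; push_cast
      linarith
    -- `H` turns translation by `s` into `G`, so adjacent increments of `H` are successive
    -- displacements of `G`.
    have hHG (v : ℝ) : H (v + s) = G (H v) := by
      rw [← hHh (G (H v)), hGs.semiconj, hhH]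
    have hHs (v : ℝ) : H v = G (H (v - s)) := by rw [← hHG, sub_add_cancel]
    have hinc : ∀ v, 0 ≤ H v - H (v - s) := fun v => by
      linarith [H.monotone (by linarith : v - s ≤ v)]
    have hinc' : ∀ v, 0 ≤ H (v + s) - H v := fun v => by
      linarith [H.monotone (by linarith : v ≤ v + s)]
    refine ⟨s, hs, ?_, ?_, ?_, ?_⟩
    · refine h2.trans ?_
      rw [div_le_iff₀ ht] at hNR1
      rw [div_le_iff₀ hNR]
      linarith
    · have h3 : t * N ≤ N₀ + 2 * A + 1 := by
        have h4 : t * N ≤ t * (N₀ + (2 * A / t + 1)) := by gcongr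
        have h5 : t * (N₀ + (2 * A / t + 1)) = t * (N₀ + 1) + 2 * A := by field_simp; ring
        have h6 : t * ((N₀ : ℝ) + 1) ≤ 1 * (N₀ + 1) := by gcongr
        linarith
      calc t = t * N / A * (A / N) := by field_simp
        _ ≤ (N₀ + 2 * A + 1) / A * s := by gcongr
        _ ≤ n * s := by gcongr
    · intro v
      have := hGs.le_mul (H (v - s))
      rw [← hHs, ← hHG] at this
      exact this.trans (mul_le_mul_of_nonneg_right hDE (hinc v))
    · rw [incrementLE_reflect]
      intro v
      have := hGs.le_mul' (H (v - s))
      rw [← hHs, ← hHG] at this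
      exact this.trans (mul_le_mul_of_nonneg_right hDE (hinc' v))
  have main : ∀ H' : ℝ → ℝ, Monotone H' → ∀ s t : ℝ, 0 < s → s ≤ t → t ≤ n * s →
      IncrementLE H' E s → IncrementLE H' (n * E ^ n) t := by
    intro H' hH' s t hs hst htn hinc v
    have h1 := hinc.mul_nat hE1 hH' hs.le n v
    have h2 := hH' (by linarith : v + t ≤ v + n * s)
    have h3 := hH' (by linarith : v - t ≤ v - s)
    have h4 : n * E ^ n * (H' v - H' (v - s)) ≤ n * E ^ n * (H' v - H' (v - t)) := by gcongr
    linarith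
  refine ⟨max 2 (n * E ^ n), by linarith [le_max_left 2 (n * E ^ n)], fun t ht => ?_⟩
  rcases le_or_gt t 1 with ht1 | ht1
  · obtain ⟨s, hs, hst, htn, h1, h2⟩ := hstep t ht ht1
    exact ⟨(main H H.monotone s t hs hst htn h1).mono H.monotone ht.le (le_max_right _ _),
      (main _ hmr s t hs hst htn h2).mono hmr ht.le (le_max_right _ _)⟩
  · refine ⟨(incrementLE_of_one_le H ht1.le).mono H.monotone ht.le (le_max_left _ _), ?_⟩
    let R : CircleDeg1Lift := ⟨⟨fun x => -H (-x), hmr⟩, fun x => by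
      change -H (-(x + 1)) = -H (-x) + 1
      have := H.map_sub_int (-x) 1
      push_cast at this
      rw [show -(x + 1) = -x - 1 by ring, this]
      ring⟩
    exact IncrementLE.mono (incrementLE_of_one_le R ht1.le) hmr ht.le (le_max_left _ _)

/-! ### Linearization of multicritical circle maps -/

/-- The inverse homeomorphisms `h` and `H` of the line conjugate the lift `F` of `f` to the
translation by `α`, and `H` is quasisymmetric. -/
structure IsLinearization (f : UnitAddCircle ≃ₜ UnitAddCircle) (F h H : CircleDeg1Lift)
    (α K : ℝ) : Prop where
  isLift : IsLift F f
  strictMono : StrictMono h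
  strictMono_inv : StrictMono H
  continuous : Continuous h
  continuous_inv : Continuous H
  left_inv : ∀ x, H (h x) = x
  right_inv : ∀ x, h (H x) = x
  semiconj : ∀ x, h (F x) = h x + α
  fract_eq : Int.fract α = rotationNumber f
  one_le : 1 ≤ K
  quasisymmetric : IsQuasisymmetricWith H K

/-- `F` and the translation are invertible lifts with the same translation number, hence
semiconjugate. At this stage `h` is only monotone of degree one. -/
theorem exists_semiconj_translation {F : CircleDeg1Lift} (hF : StrictMono F) (hFc : Continuous F) :
    ∃ h : CircleDeg1Lift, ∀ x, h (F x) = h x + F.translationNumber := by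
  have hbij : Function.Bijective F := ⟨hF.injective, F.continuous_iff_surjective.1 hFc⟩
  obtain ⟨h, hh⟩ := CircleDeg1Lift.semiconj_of_isUnit_of_translationNumber_eq
    (CircleDeg1Lift.isUnit_iff_bijective.2 hbij)
    (CircleDeg1Lift.translate (Multiplicative.ofAdd F.translationNumber)).isUnit
    (CircleDeg1Lift.translationNumber_translate _).symm
  refine ⟨h, fun x => ?_⟩
  rw [hh x, CircleDeg1Lift.translate_apply, add_comm]

theorem IsMulticritical.exists_isLinearization {f : UnitAddCircle ≃ₜ UnitAddCircle}
    (hf : IsMulticritical f) {c₀ : ℝ} (hc₀ : 0 < c₀)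
    (hbad : BadlyApproximableWith c₀ (rotationNumber f)) :
    ∃ (F h H : CircleDeg1Lift) (α K : ℝ), IsLinearization f F h H α K := by
  obtain ⟨F, hF, hC, hfin, -, hcr⟩ := hf
  have hrot := rotationNumber_eq hF
  have hbadF : BadlyApproximableWith c₀ F.translationNumber := by
    have := hbad.add_int ⌊F.translationNumber⌋
    rwa [hrot, Int.fract_add_floor] at this
  obtain ⟨h, hsemi⟩ := exists_semiconj_translation hF.strictMono hF.continuous
  obtain ⟨C, K, δ, S, hC1, hK, hδ, hB⟩ := exists_crossRatioBounds hF.strictMono hC hfin hcr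
  obtain ⟨D, A, N₀, hD, hA, hN₀, hG⟩ := exists_comparableDisplacement hF.strictMono hF.continuous
    hsemi hc₀ hbadF hC1 hK hδ hB
  have hmono := strictMono_of_comparableDisplacement hD hA hN₀ hG
  have hcont := continuous_of_semiconj hsemi hc₀ hbadF
  obtain ⟨u, hu⟩ := CircleDeg1Lift.isUnit_iff_bijective.2
    ⟨hmono.injective, h.continuous_iff_surjective.1 hcont⟩
  have hl (x : ℝ) : (u⁻¹ : CircleDeg1Liftˣ).val (h x) = x := by
    rw [← hu, CircleDeg1Lift.units_inv_apply_apply]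
  have hr (x : ℝ) : h ((u⁻¹ : CircleDeg1Liftˣ).val x) = x := by
    rw [← hu, CircleDeg1Lift.units_apply_inv_apply]
  obtain ⟨K', hK', hqs⟩ := exists_isQuasisymmetricWith_inverse hA hN₀ hl hr hG
  exact ⟨F, h, (u⁻¹ : CircleDeg1Liftˣ).val, F.translationNumber, K', hF, hmono,
    CircleDeg1Lift.strictMono_iff_injective _ |>.2 (Function.LeftInverse.injective hr), hcont,
    (CircleDeg1Lift.continuous_iff_surjective _).2 (Function.RightInverse.surjective hl), hl, hr,
    hsemi, hrot.symm, hK', hqs⟩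

/-! ### From the line to the circle -/

/-- The circle map with lift `P`. -/
noncomputable def toCircleFun (P : CircleDeg1Lift) : UnitAddCircle → UnitAddCircle :=
  Function.Periodic.lift (f := fun x : ℝ => ((P x : ℝ) : UnitAddCircle)) (c := 1) fun x => by
    simp only [P.map_add_one, AddCircle.coe_add, AddCircle.coe_period, add_zero]

theorem toCircleFun_coe (P : CircleDeg1Lift) (x : ℝ) :
    toCircleFun P (x : UnitAddCircle) = (P x : ℝ) := rfl

theorem continuous_toCircleFun {P : CircleDeg1Lift} (hP : Continuous P) :
    Continuous (toCircleFun P) := by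
  rw [(QuotientAddGroup.isQuotientMap_mk (N := AddSubgroup.zmultiples (1 : ℝ))).continuous_iff]
  exact (AddCircle.continuous_mk' (1 : ℝ)).comp hP

/-- The circle homeomorphism with lift `P`, where `Q` is the inverse of `P`. -/
noncomputable def toCircleHomeo (P Q : CircleDeg1Lift) (hP : Continuous P) (hQ : Continuous Q)
    (hQP : ∀ x, Q (P x) = x) (hPQ : ∀ x, P (Q x) = x) : UnitAddCircle ≃ₜ UnitAddCircle where
  toFun := toCircleFun P
  invFun := toCircleFun Q
  left_inv y := by
    induction y using QuotientAddGroup.induction_on with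
    | H x => exact congrArg _ (hQP x)
  right_inv y := by
    induction y using QuotientAddGroup.induction_on with
    | H x => exact congrArg _ (hPQ x)
  continuous_toFun := continuous_toCircleFun hP
  continuous_invFun := continuous_toCircleFun hQ

/-- A continuous circle map which commutes with an irrational rotation is a rotation. -/
theorem eq_add_of_commute_rotation {α : ℝ} (hα : Irrational α) {φ : UnitAddCircle → UnitAddCircle}
    (hφ : Continuous φ) (hcomm : ∀ y, φ (y + (α : UnitAddCircle)) = φ y + (α : UnitAddCircle))
    (y : UnitAddCircle) : φ y = y + φ 0 := by
  -- The two sides agree on the orbit of `0`, which is dense as `α` is irrational.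
  have hz (n : ℤ) : φ (n • (α : UnitAddCircle)) = n • (α : UnitAddCircle) + φ 0 := by
    induction n with
    | zero => simp
    | succ n ih => rw [add_zsmul, one_zsmul, hcomm, ih]; abel
    | pred n ih =>
      have := hcomm ((-(n : ℤ) - 1) • (α : UnitAddCircle))
      rw [sub_zsmul, one_zsmul, neg_add_cancel_right, ih] at this
      rw [sub_zsmul, one_zsmul, ← sub_eq_iff_eq_add.2 this]
      abel
  have hdense : DenseRange fun n : ℤ => n • (α : UnitAddCircle) := by
    rw [AddCircle.denseRange_zsmul_coe_iff]
    simpa using hα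
  have := DenseRange.equalizer hdense hφ (continuous_id.add continuous_const : Continuous
    fun y : UnitAddCircle => y + φ 0) (funext fun n => hz n)
  exact congrFun this y

theorem IsQuasisymmetricWith.isQuasisymmetric {k : UnitAddCircle ≃ₜ UnitAddCircle}
    {P : CircleDeg1Lift} (hP : IsLift P k) {K : ℝ} (hK : 1 ≤ K) (h : IsQuasisymmetricWith P K) :
    IsQuasisymmetric k := by
  refine ⟨P, hP, K, hK, fun x t ht => ?_⟩
  have h1 := (h t ht).1 x
  have h2 := incrementLE_reflect.1 (h t ht).2 x
  have h3 : 0 < P x - P (x - t) := by linarith [hP.strictMono (by linarith : x - t < x)]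
  constructor
  · rw [div_le_div_iff₀ (by linarith) h3]; linarith
  · rwa [div_le_iff₀ h3]

section Conjugacy

variable {f g : UnitAddCircle ≃ₜ UnitAddCircle} {F hf Hf G hg Hg : CircleDeg1Lift} {α β K K' : ℝ}

theorem IsLinearization.inv_add (L : IsLinearization f F hf Hf α K) (x : ℝ) :
    Hf (x + α) = F (Hf x) := by
  rw [← L.left_inv (F (Hf x)), L.semiconj, L.right_inv]

theorem coe_eq_coe_of_fract_eq {α β : ℝ} (h : Int.fract α = Int.fract β) :
    (α : UnitAddCircle) = (β : UnitAddCircle) := by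
  rw [← sub_eq_zero, ← AddCircle.coe_sub, AddCircle.coe_eq_zero_iff]
  refine ⟨⌊α⌋ - ⌊β⌋, ?_⟩
  rw [zsmul_eq_mul, mul_one]
  push_cast
  linarith [Int.fract_add_floor α, Int.fract_add_floor β]

/-- The lift `x ↦ Hg (hf x + a)`. -/
def compShift (hf Hg : CircleDeg1Lift) (a : ℝ) : CircleDeg1Lift :=
  ⟨⟨fun x => Hg (hf x + a), fun _ _ hxy => Hg.monotone (by linarith [hf.monotone hxy])⟩, fun x => by
    change Hg (hf (x + 1) + a) = Hg (hf x + a) + 1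
    rw [hf.map_add_one, ← Hg.map_add_one]
    congr 1; ring⟩

theorem compShift_apply (hf Hg : CircleDeg1Lift) (a x : ℝ) :
    compShift hf Hg a x = Hg (hf x + a) := rfl

/-- The conjugacy is `Hg ∘ hf`; `α` and `β` differ by an integer, so they induce the same rotation.
-/
theorem IsLinearization.exists_conjugacy (L : IsLinearization f F hf Hf α K)
    (L' : IsLinearization g G hg Hg β K') (hαβ : Int.fract α = Int.fract β) :
    ∃ k : UnitAddCircle ≃ₜ UnitAddCircle, IsConjugacy k f g := by
  have c1 : Continuous (compShift hf Hg 0) :=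
    L'.continuous_inv.comp (L.continuous.add continuous_const)
  have c2 : Continuous (compShift hg Hf 0) :=
    L.continuous_inv.comp (L'.continuous.add continuous_const)
  refine ⟨toCircleHomeo (compShift hf Hg 0) (compShift hg Hf 0) c1 c2
    (fun x => by simp [compShift_apply, L.left_inv, L'.right_inv])
    (fun x => by simp [compShift_apply, L'.left_inv, L.right_inv]), fun y => ?_⟩
  induction y using QuotientAddGroup.induction_on with
  | H x =>
    change toCircleFun _ (f (x : UnitAddCircle)) = g (toCircleFun _ (x : UnitAddCircle))
    rw [← L.isLift.coe_eq, toCircleFun_coe, toCircleFun_coe, ← L'.isLift.coe_eq, compShift_apply,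
      compShift_apply, L.semiconj, add_zero, add_zero, ← L'.inv_add, ← toCircleFun_coe,
      ← toCircleFun_coe, AddCircle.coe_add, AddCircle.coe_add, coe_eq_coe_of_fract_eq hαβ]

/-- The map `hg ∘ k ∘ Hf` commutes with the rotation by `α`, so it is a rotation by some `a`. This
provides an increasing lift of `k`, so preservation of orientation is a conclusion. -/
theorem IsLinearization.isQuasisymmetric_of_isConjugacy (L : IsLinearization f F hf Hf α K)
    (L' : IsLinearization g G hg Hg β K') (hαβ : Int.fract α = Int.fract β) (hα : Irrational α)
    {k : UnitAddCircle ≃ₜ UnitAddCircle} (hk : IsConjugacy k f g) : IsQuasisymmetric k := by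
  have hφ : Continuous fun y => toCircleFun hg (k (toCircleFun Hf y)) :=
    (continuous_toCircleFun L'.continuous).comp
      (k.continuous.comp (continuous_toCircleFun L.continuous_inv))
  have e1 (y : UnitAddCircle) : toCircleFun Hf (y + (α : UnitAddCircle)) =
      f (toCircleFun Hf y) := by
    induction y using QuotientAddGroup.induction_on with
    | H x =>
      change toCircleFun Hf ((x + α : ℝ) : UnitAddCircle) = f (toCircleFun Hf (x : UnitAddCircle))
      rw [toCircleFun_coe, toCircleFun_coe, L.inv_add, L.isLift.coe_eq]
  have e2 (y : UnitAddCircle) : toCircleFun hg (g y) =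
      toCircleFun hg y + (α : UnitAddCircle) := by
    induction y using QuotientAddGroup.induction_on with
    | H x =>
      change toCircleFun hg (g (x : UnitAddCircle)) = toCircleFun hg (x : UnitAddCircle) + _
      rw [← L'.isLift.coe_eq, toCircleFun_coe, toCircleFun_coe, L'.semiconj, AddCircle.coe_add,
        coe_eq_coe_of_fract_eq hαβ]
  have hrot := eq_add_of_commute_rotation hα hφ (fun y => by rw [e1, hk, e2])
  obtain ⟨a, ha⟩ := QuotientAddGroup.mk_surjective (toCircleFun hg (k (toCircleFun Hf 0)))
  have hlift : IsLift (compShift hf Hg a) k := by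
    refine ⟨L'.continuous_inv.comp (L.continuous.add continuous_const), fun x y hxy =>
      L'.strictMono_inv (by linarith [L.strictMono hxy]), fun x => ?_⟩
    have h1 := hrot (hf x : ℝ)
    rw [← ha, toCircleFun_coe, L.left_inv] at h1
    obtain ⟨z, hz⟩ := QuotientAddGroup.mk_surjective (k (x : UnitAddCircle))
    change (z : UnitAddCircle) = _ at hz
    rw [← hz, toCircleFun_coe] at h1
    change _ = ((hf x : ℝ) : UnitAddCircle) + (a : UnitAddCircle) at h1
    rw [← AddCircle.coe_add] at h1
    rw [compShift_apply, ← hz, ← toCircleFun_coe, ← h1, toCircleFun_coe, L'.left_inv]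
  obtain ⟨M, hM, hqs⟩ := L.quasisymmetric.comp_inverse L.one_le L'.one_le L.strictMono
    L.strictMono_inv L'.strictMono_inv L.left_inv L'.quasisymmetric a
  exact IsQuasisymmetricWith.isQuasisymmetric hlift hM hqs

end Conjugacy

end CircleMap

theorem mainTheorem6 (f g : UnitAddCircle ≃ₜ UnitAddCircle)
    (hf : CircleMap.IsMulticritical f) (hg : CircleMap.IsMulticritical g)
    (hfg : CircleMap.rotationNumber f = CircleMap.rotationNumber g)
    (hirr : Irrational (CircleMap.rotationNumber f))
    (hbdd : CircleMap.IsBoundedType (CircleMap.rotationNumber f)) :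
    (∃ h : UnitAddCircle ≃ₜ UnitAddCircle,
      CircleMap.IsConjugacy h f g ∧ CircleMap.IsQuasisymmetric h) ∧
    ∀ h : UnitAddCircle ≃ₜ UnitAddCircle,
      CircleMap.IsConjugacy h f g → CircleMap.IsQuasisymmetric h := by
  obtain ⟨c₀, hc₀, hbad⟩ := hbdd.exists_badlyApproximableWith hirr
  obtain ⟨F, hF, HF, α, K, L⟩ := hf.exists_isLinearization hc₀ hbad
  obtain ⟨G, hG, HG, β, K', L'⟩ := hg.exists_isLinearization hc₀ (hfg ▸ hbad)
  have hαβ : Int.fract α = Int.fract β := by rw [L.fract_eq, L'.fract_eq, hfg]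
  have hα : Irrational α := by
    have h1 : Irrational (Int.fract α) := L.fract_eq ▸ hirr
    rw [← Int.fract_add_floor α]
    exact h1.add_intCast _
  have key : ∀ h : UnitAddCircle ≃ₜ UnitAddCircle,
      CircleMap.IsConjugacy h f g → CircleMap.IsQuasisymmetric h := fun h hh =>
    L.isQuasisymmetric_of_isConjugacy L' hαβ hα hh
  obtain ⟨h, hh⟩ := L.exists_conjugacy L' hαβ
  exact ⟨⟨h, hh, key h hh⟩, key⟩
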